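/- All graphs are finite and undirected. For positive integers $m,n,k$ with $m\ge 2n$, the helical graph $H(m,n,k)$ has as vertices all $k$-tuples $(A_1,\dots,A_k)$ of subsets of $\{1,\dots,m\}$ with $|A_1|=n$, $|A_r|\ge n$ for $1\le r\le k$, $A_s\cap A_{s+1}=\emptyset$ for $1\le s\le k-1$, and $A_t\subseteq A_{t+2}$ for $1\le t\le k-2$; two vertices $(A_1,\dots,A_k)$ and $(B_1,\dots,B_k)$ are adjacent if $A_i\cap B_i=\emptyset$ for $1\le i\le k$ and $A_j\subseteq B_{j+1}$, $B_j\subseteq A_{j+1}$ for $1\le j\le k-1$. The $k$-th power $G^{k}$ of a graph $G$ has the same vertices as $G$, and $u,v$ (possibly equal) are adjacent in $G^k$ if there is a walk of length exactly $k$ between them in $G$. For integers $r,s\ge 0$, the fractional power $G^{\frac{2r+1}{2s+1}}$ of a loopless graph $G$ is the $(2r+1)$-st power of the graph obtained from $G$ by replacing each edge by a path with exactly $2s$ inner vertices. Let $og(G)$ be the length of a shortest odd cycle of $G$ and $\chi(G)$ its chromatic number. The power thickness of a loopless non-bipartite graph $G$ is $$\theta(G)=\sup\Bigl\{\tfrac{2r+1}{2s+1}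 : r,s\ge 0 \text{ integers},\ \chi\bigl(G^{\frac{2r+1}{2s+1}}\bigr)\le\chi(G),\ \tfrac{2r+1}{2s+1}<og(G)\Bigr\}.$$ Theorem. Let $k,l,m$ be positive integers with $m\ge 3$ and $\frac{2l-1}{2k-1}\le 1$. Then $H(m,1,k)^{2l-1}$ is loopless and non-bipartite, and $$\theta\bigl(H(m,1,k)^{2l-1}\bigr)=\frac{2k-1}{2l-1}.$$ -/

import Mathlib

/-- An undirected graph in which loops are allowed (powers of a simple graph can have loops):
a symmetric adjacency relation. -/
structure LoopGraph (V : Type*) where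
  Adj : V → V → Prop
  symm : ∀ u v, Adj u v → Adj v u

namespace LoopGraph

/-- There is a walk of length exactly `n` from `u` to `v`. -/
def HasWalk {V : Type*} (G : LoopGraph V) : ℕ → V → V → Prop
  | 0, u, v => u = v
  | n + 1, u, v => ∃ w, G.Adj u w ∧ G.HasWalk n w v

theorem HasWalk.concat {V : Type*} {G : LoopGraph V} {n : ℕ} {u v w : V}
    (h : G.HasWalk n u v) (hvw : G.Adj v w) : G.HasWalk (n + 1) u w := by
  induction n generalizing u with
  | zero =>
    have h' : u = v := h
    subst h'
    exact ⟨w, hvw, rfl⟩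
  | succ n ih =>
    obtain ⟨x, hux, hx⟩ := h
    exact ⟨x, hux, ih hx⟩

theorem HasWalk.reverse {V : Type*} {G : LoopGraph V} {n : ℕ} {u v : V}
    (h : G.HasWalk n u v) : G.HasWalk n v u := by
  induction n generalizing u with
  | zero => exact Eq.symm h
  | succ n ih =>
    obtain ⟨x, hux, hx⟩ := h
    exact (ih hx).concat (G.symm _ _ hux)

/-- The `k`-th power of `G`: same vertices, `u` and `v` (possibly equal) are adjacent iff there is
a walk of length `k` between them in `G`. -/
def power {V : Type*} (G : LoopGraph V) (k : ℕ) : LoopGraph V where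
  Adj u v := G.HasWalk k u v
  symm _ _ h := h.reverse

/-- An edge of `G` together with an orientation. -/
def Dart {V : Type*} (G : LoopGraph V) : Type _ := {p : V × V // G.Adj p.1 p.2}

/-- The same edge with the opposite orientation. -/
def Dart.rev {V : Type*} {G : LoopGraph V} (d : G.Dart) : G.Dart :=
  ⟨(d.1.2, d.1.1), G.symm _ _ d.2⟩

theorem Dart.rev_rev {V : Type*} {G : LoopGraph V} (d : G.Dart) : d.rev.rev = d := rfl

/-- The vertices of the `(2s+1)`-subdivision of a loopless graph `G`: the vertices of `G`, and for
each edge `uv` the `2s` inner vertices `(uv)_1, …, (uv)_s, (vu)_1, …, (vu)_s` of the path that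
replaces it, where `(uv)_i` is the vertex at distance `2i` from `u` on that path. -/
abbrev SubdivVertex {V : Type*} (G : LoopGraph V) (s : ℕ) : Type _ := V ⊕ (G.Dart × Fin s)

/-- The vertex `(uv)_i`, `0 ≤ i ≤ s`, with `(uv)_0 = u`. -/
def subdivPoint {V : Type*} (G : LoopGraph V) (s : ℕ) (d : G.Dart) (i : Fin (s + 1)) :
    G.SubdivVertex s :=
  Fin.cases (Sum.inl d.1.1) (fun j => Sum.inr (d, j)) i

/-- The `(2s+1)`-subdivision of a loopless graph `G`, i.e. each edge is replaced by a path with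
exactly `2s` inner vertices. The edges of the path that replaces `uv` are
`(uv)_i (vu)_{s-i}` for `0 ≤ i ≤ s` and `(uv)_j (vu)_{s-j+1}` for `1 ≤ j ≤ s`
(in the second family, `j : Fin s` stands for the label `j + 1`). -/
def oddSubdivision {V : Type*} (G : LoopGraph V) (s : ℕ) : LoopGraph (G.SubdivVertex s) where
  Adj x y := ∃ d : G.Dart,
    (∃ i : Fin (s + 1), x = G.subdivPoint s d i ∧ y = G.subdivPoint s d.rev i.rev) ∨
    (∃ j : Fin s, x = G.subdivPoint s d j.succ ∧ y = G.subdivPoint s d.rev j.rev.succ)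
  symm := by
    rintro x y ⟨d, ⟨i, rfl, rfl⟩ | ⟨j, rfl, rfl⟩⟩
    · exact ⟨d.rev, Or.inl ⟨i.rev, rfl, by rw [Fin.rev_rev, Dart.rev_rev]⟩⟩
    · exact ⟨d.rev, Or.inr ⟨j.rev, rfl, by rw [Fin.rev_rev, Dart.rev_rev]⟩⟩

/-- The fractional power `G^((2r+1)/(2s+1))`: the `(2r+1)`-st power of the
`(2s+1)`-subdivision. -/
def fracPower {V : Type*} (G : LoopGraph V) (r s : ℕ) : LoopGraph (G.SubdivVertex s) :=
  (G.oddSubdivision s).power (2 * r + 1)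

/-- `G` has a proper colouring with `n` colours. -/
def Colorable {V : Type*} (G : LoopGraph V) (n : ℕ) : Prop :=
  ∃ c : V → Fin n, ∀ u v, G.Adj u v → c u ≠ c v

/-- The chromatic number (`⊤` if there is no proper colouring with finitely many colours). -/
noncomputable def chromaticNumber {V : Type*} (G : LoopGraph V) : ℕ∞ :=
  ⨅ n ∈ {n : ℕ | G.Colorable n}, (n : ℕ∞)

/-- `G` contains a cycle of odd length `n` (for `n = 1`, a loop). -/
def HasOddCycle {V : Type*} (G : LoopGraph V) (n : ℕ) : Prop :=
  Odd n ∧ ∃ c : ZMod n → V, Function.Injective c ∧ ∀ i, G.Adj (c i) (c (i + 1))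

/-- The odd girth: the length of a shortest odd cycle (`⊤` if there is none). -/
noncomputable def oddGirth {V : Type*} (G : LoopGraph V) : ℕ∞ :=
  ⨅ n ∈ {n : ℕ | G.HasOddCycle n}, (n : ℕ∞)

/-- The power thickness of a (loopless, non-bipartite) graph `G`: the supremum of the fractions
`(2r+1)/(2s+1)` less than the odd girth of `G` with `χ(G^((2r+1)/(2s+1))) ≤ χ(G)`. -/
noncomputable def powerThickness {V : Type*} (G : LoopGraph V) : ℝ :=
  sSup {x : ℝ | ∃ r s : ℕ, x = (2 * (r : ℝ) + 1) / (2 * (s : ℝ) + 1) ∧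
    (G.fracPower r s).chromaticNumber ≤ G.chromaticNumber ∧
    ENNReal.ofReal x < (G.oddGirth : ENNReal)}

end LoopGraph

/-- The vertices of the helical graph `H(m,n,k)`: tuples `(A_1, …, A_k)` of subsets of an
`m`-element set (indexed here from `0`). -/
def HelicalVertex (m n k : ℕ) : Type :=
  {A : Fin k → Finset (Fin m) //
    (∀ r : Fin k, (r : ℕ) = 0 → (A r).card = n) ∧
    (∀ r, n ≤ (A r).card) ∧
    (∀ s s' : Fin k, (s' : ℕ) = (s : ℕ) + 1 → Disjoint (A s) (A s')) ∧
    (∀ t t' : Fin k, (t' : ℕ) = (t : ℕ) + 2 → A t ⊆ A t')}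

/-- The helical graph `H(m,n,k)`. -/
def helical (m n k : ℕ) : LoopGraph (HelicalVertex m n k) where
  Adj A B := (∀ i, Disjoint (A.1 i) (B.1 i)) ∧
    ∀ j j' : Fin k, (j' : ℕ) = (j : ℕ) + 1 → A.1 j ⊆ B.1 j' ∧ B.1 j ⊆ A.1 j'
  symm _ _ h := ⟨fun i => (h.1 i).symm, fun j j' hj => (h.2 j j' hj).symm⟩

/-!
Write `H` for the helical graph `H(m,1,k)`, `b = 2k-1`, `a = 2l-1 ≤ b` and `G = H ^ a`; the exponent
`c/d` of a fractional power stands for the `c`-th power of the `d`-subdivision, `c` and `d` odd.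
In the lemmas, `k` and `l` are shifted by one, so that `b = 2k+1` and `a = 2l+1` there.

**The helical graph is universal.** A graph `X` has a homomorphism to `H` as soon as its `b`-th power
has a proper `m`-colouring: list the sets of colours at walk distance `0, 1, …, k-1`
(`exists_isHom_helical`); and `H ^ b` itself is `m`-colourable (`helical_power_colorable`). In this
way, `m`-colourings of `b`-th powers become homomorphisms to `H`. Subdivision and power are adjoint
in a weak sense: homomorphisms from `X` to the `d`-th power of `Z` extend to the `d`-subdivision
of `X` (`exists_isHom_oddSubdivision`), and the `d`-th power of the `d`-subdivision of `X` is
homomorphically equivalent to `X` (`isHom_subdivBase`, `isHom_inl_power_oddSubdivision`).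

**The chromatic number of `H` and `G` is `m`.** Since `H → G → H ^ b`, only the lower bound for `H`
needs an argument, and by universality it is enough to find one graph of chromatic number at least
`m` whose `b`-th power is `m`-colourable. A Schrijver-type graph on a long path does it: stable sets
of nearly maximal size in `m` blocks of odd length can be coloured by a block that they fill, and
this colouring is proper even for long odd walks (`stableKneser_power_colorable`), while the lower
bound for the number of colours (`lt_of_stableKneser_colorable`) follows from Tucker's lemma, applied
to a labelling of sign vectors by the lengths of their alternating subsequences and by colours.
Tucker's lemma in turn comes from Fan's parity count of alternating chains of sign vectors
(`sum_altTuple_signChain`). So `G` is loopless, and it is not bipartite as `m ≥ 3`.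

**The value `b/a` is attained.** The identity `G → H ^ a` extends to a homomorphism from the
`a`-subdivision of `G` to `H`, so that `G ^ (b/a) → H ^ b` is `m`-colourable. An odd cycle of length
`n` in `G` is a closed walk of length `an` in `H`, whence `an > b`.

**No larger value occurs.** Let `G ^ (c/d)` be `m`-colourable with `ca > db`, and let `C` be the core
of `G`. Subdividing further and applying universality gives a homomorphism from `C ^ (ca/(db))`
to `G`, hence to `C` (`mul_le_mul_of_fracPower_colorable`). For a core this forces, by induction
along the subdivided edges, the ends of every walk of length `3` to be adjacent; as a core cannot be
folded, each vertex then has at most one neighbour and `C` is bipartite (`IsCore.colorable_two`),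
contradicting `m ≥ 3`.
-/

/-! ### Homomorphisms, walks and subdivisions -/

namespace LoopGraph

section Walks

variable {V W U : Type*}

/-- `f` is a graph homomorphism from `G` to `X`. -/
def IsHom (G : LoopGraph V) (X : LoopGraph W) (f : V → W) : Prop :=
  ∀ u v, G.Adj u v → X.Adj (f u) (f v)

theorem IsHom.comp {G : LoopGraph V} {X : LoopGraph W} {Y : LoopGraph U} {g : W → U} {f : V → W}
    (hg : X.IsHom Y g) (hf : G.IsHom X f) : G.IsHom Y (g ∘ f) :=
  fun _ _ h => hg _ _ (hf _ _ h)

theorem IsHom.hasWalk {G : LoopGraph V} {X : LoopGraph W} {f : V → W} (hf : G.IsHom X f)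
    {n : ℕ} {u v : V} (h : G.HasWalk n u v) : X.HasWalk n (f u) (f v) := by
  induction n generalizing u with
  | zero => exact congrArg f h
  | succ n ih =>
    obtain ⟨x, hux, hx⟩ := h
    exact ⟨f x, hf _ _ hux, ih hx⟩

theorem IsHom.power {G : LoopGraph V} {X : LoopGraph W} {f : V → W} (hf : G.IsHom X f) (n : ℕ) :
    (G.power n).IsHom (X.power n) f :=
  fun _ _ h => hf.hasWalk h

theorem IsHom.colorable {G : LoopGraph V} {X : LoopGraph W} {f : V → W} (hf : G.IsHom X f) {n : ℕ}
    (h : X.Colorable n) : G.Colorable n := by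
  obtain ⟨c, hc⟩ := h
  exact ⟨c ∘ f, fun u v huv => hc _ _ (hf _ _ huv)⟩

theorem Colorable.not_adj_self {G : LoopGraph V} {n : ℕ} (h : G.Colorable n) (v : V) :
    ¬ G.Adj v v := by
  obtain ⟨c, hc⟩ := h
  exact fun hv => hc _ _ hv rfl

theorem Colorable.mono {G : LoopGraph V} {n k : ℕ} (h : G.Colorable n) (hnk : n ≤ k) :
    G.Colorable k := by
  obtain ⟨c, hc⟩ := h
  exact ⟨fun v => Fin.castLE hnk (c v), fun u v huv e => hc u v huv (Fin.castLE_injective hnk e)⟩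

variable {G : LoopGraph V}

theorem hasWalk_one {u v : V} : G.HasWalk 1 u v ↔ G.Adj u v := by
  constructor
  · rintro ⟨w, h, rfl⟩
    exact h
  · exact fun h => ⟨v, h, rfl⟩

theorem hasWalk_add {m n : ℕ} {u w : V} :
    G.HasWalk (m + n) u w ↔ ∃ v, G.HasWalk m u v ∧ G.HasWalk n v w := by
  induction m generalizing u with
  | zero =>
    rw [Nat.zero_add]
    exact ⟨fun h => ⟨u, rfl, h⟩, fun ⟨v, h, h'⟩ => by obtain rfl : u = v := h; exact h'⟩
  | succ m ih =>
    rw [Nat.add_right_comm]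
    constructor
    · rintro ⟨x, hux, hx⟩
      obtain ⟨v, h, h'⟩ := ih.1 hx
      exact ⟨v, ⟨x, hux, h⟩, h'⟩
    · rintro ⟨v, ⟨x, hux, h⟩, h'⟩
      exact ⟨x, hux, ih.2 ⟨v, h, h'⟩⟩

theorem HasWalk.append {m n : ℕ} {u v w : V} (h : G.HasWalk m u v) (h' : G.HasWalk n v w) :
    G.HasWalk (m + n) u w :=
  hasWalk_add.2 ⟨v, h, h'⟩

theorem hasWalk_power {a n : ℕ} {u v : V} :
    (G.power a).HasWalk n u v ↔ G.HasWalk (a * n) u v := by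
  induction n generalizing u with
  | zero => exact Iff.rfl
  | succ n ih =>
    rw [Nat.mul_succ, Nat.add_comm (a * n), hasWalk_add (G := G)]
    exact ⟨fun ⟨x, hx, h⟩ => ⟨x, hx, ih.1 h⟩, fun ⟨x, hx, h⟩ => ⟨x, hx, ih.2 h⟩⟩

/-- A walk with at least one edge can be lengthened by `2`: go back and forth along its first
edge. -/
theorem HasWalk.add_two {n : ℕ} {u v : V} (hn : 1 ≤ n) (h : G.HasWalk n u v) :
    G.HasWalk (n + 2) u v := by
  obtain ⟨k, rfl⟩ := Nat.exists_eq_add_of_le' hn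
  obtain ⟨x, hux, hx⟩ := h
  exact ⟨x, hux, u, G.symm _ _ hux, x, hux, hx⟩

theorem HasWalk.add_two_mul {n : ℕ} {u v : V} (hn : 1 ≤ n) (h : G.HasWalk n u v) (j : ℕ) :
    G.HasWalk (n + 2 * j) u v := by
  induction j with
  | zero => exact h
  | succ j ih => exact HasWalk.add_two (n := n + 2 * j) (by omega) ih

theorem HasWalk.of_odd_le {n k : ℕ} {u v : V} (h : G.HasWalk n u v) (hn : Odd n) (hk : Odd k)
    (hnk : n ≤ k) : G.HasWalk k u v := by
  obtain ⟨a, rfl⟩ := hn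
  obtain ⟨b, rfl⟩ := hk
  have := h.add_two_mul (by omega) (b - a)
  rwa [show 2 * a + 1 + 2 * (b - a) = 2 * b + 1 by omega] at this

theorem isHom_power_of_odd (G : LoopGraph V) {n : ℕ} (hn : Odd n) : G.IsHom (G.power n) id :=
  fun _ _ h => (hasWalk_one.2 h).of_odd_le odd_one hn hn.pos

/-- A walk of length `n` as a sequence of vertices indexed by `ℕ`. -/
theorem HasWalk.exists_seq {n : ℕ} {u v : V} (h : G.HasWalk n u v) :
    ∃ p : ℕ → V, p 0 = u ∧ p n = v ∧ ∀ i < n, G.Adj (p i) (p (i + 1)) := by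
  induction n generalizing u with
  | zero => exact ⟨fun _ => u, rfl, h, fun i hi => by omega⟩
  | succ n ih =>
    obtain ⟨x, hux, hx⟩ := h
    obtain ⟨p, h0, hn, hp⟩ := ih hx
    refine ⟨fun i => Nat.casesOn i u p, rfl, hn, fun i hi => ?_⟩
    cases i with
    | zero => simpa [h0] using hux
    | succ i => exact hp i (by omega)

theorem hasWalk_of_seq {n : ℕ} (p : ℕ → V) (h : ∀ i < n, G.Adj (p i) (p (i + 1))) :
    G.HasWalk n (p 0) (p n) := by
  induction n with
  | zero => rfl
  | succ n ih => exact (ih fun i hi => h i (by omega)).concat (h n (by omega))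

/-- If `B r u` contains everything that `f` does on the vertices at walk distance `r` from `u`, and
`B s u × B s v` consists of edges of `X` for every edge `uv` of `G`, then `f` is a homomorphism
from the `(2s+1)`-st power of `G` to `X`. -/
theorem isHom_power_of_balls {X : LoopGraph W} {f : V → W} {s : ℕ} (B : ℕ → V → Set W)
    (h0 : ∀ u, f u ∈ B 0 u)
    (hstep : ∀ r < s, ∀ u v, G.Adj u v → B r u ⊆ B (r + 1) v)
    (hfin : ∀ u v, G.Adj u v → ∀ a ∈ B s u, ∀ b ∈ B s v, X.Adj a b) :
    (G.power (2 * s + 1)).IsHom X f := by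
  have key : ∀ r ≤ s, ∀ u v, G.HasWalk r u v → f v ∈ B r u := by
    intro r
    induction r with
    | zero =>
      rintro - u v h
      obtain rfl : u = v := h
      exact h0 u
    | succ r ih =>
      rintro hr u v ⟨x, hux, hx⟩
      exact hstep r (by omega) _ _ (G.symm _ _ hux) (ih (by omega) x v hx)
  intro u v huv
  have huv' : G.HasWalk (s + (1 + s)) u v := by
    rw [show s + (1 + s) = 2 * s + 1 by omega]; exact huv
  obtain ⟨x, hux, hx⟩ := hasWalk_add.1 huv'
  obtain ⟨y, hxy, hy⟩ := hasWalk_add.1 hx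
  exact hfin x y (hasWalk_one.1 hxy) _ (key s le_rfl x u hux.reverse) _ (key s le_rfl y v hy)

end Walks

section Subdivision

variable {V W : Type*} {G : LoopGraph V}

theorem subdivPoint_zero (s : ℕ) (d : G.Dart) : G.subdivPoint s d 0 = Sum.inl d.1.1 := rfl

/-- The edges of the subdivision with labels in `ℕ`: `(uv)_i` is adjacent to `(vu)_j` when
`i + j` is `s` or `s + 1`. -/
theorem oddSubdivision_adj_of_add {s : ℕ} (d : G.Dart) (i j : Fin (s + 1))
    (h : (i : ℕ) + j = s ∨ (i : ℕ) + j = s + 1) :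
    (G.oddSubdivision s).Adj (G.subdivPoint s d i) (G.subdivPoint s d.rev j) := by
  refine ⟨d, ?_⟩
  rcases h with h | h
  · refine Or.inl ⟨i, rfl, ?_⟩
    congr 1
    ext
    rw [Fin.val_rev]
    omega
  · have hi : (i : ℕ) - 1 < s := by omega
    refine Or.inr ⟨⟨i - 1, hi⟩, ?_, ?_⟩
    · congr 1
      ext
      simp only [Fin.val_succ]
      omega
    · congr 1
      ext
      simp only [Fin.val_succ, Fin.val_rev]
      omega

theorem exists_of_oddSubdivision_adj {s : ℕ} {x y : G.SubdivVertex s}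
    (h : (G.oddSubdivision s).Adj x y) :
    ∃ (d : G.Dart) (i j : Fin (s + 1)), ((i : ℕ) + j = s ∨ (i : ℕ) + j = s + 1) ∧
      x = G.subdivPoint s d i ∧ y = G.subdivPoint s d.rev j := by
  obtain ⟨d, ⟨i, hx, hy⟩ | ⟨j, hx, hy⟩⟩ := h
  · refine ⟨d, i, i.rev, Or.inl ?_, hx, hy⟩
    rw [Fin.val_rev]
    omega
  · refine ⟨d, j.succ, j.rev.succ, Or.inr ?_, hx, hy⟩
    simp only [Fin.val_succ, Fin.val_rev]
    omega

theorem hasWalk_inl_subdivPoint {s : ℕ} (d : G.Dart) (i : ℕ) (hi : i < s + 1) :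
    (G.oddSubdivision s).HasWalk (2 * i) (Sum.inl d.1.1) (G.subdivPoint s d ⟨i, hi⟩) := by
  induction i with
  | zero => rfl
  | succ i ih =>
    have h1 := oddSubdivision_adj_of_add d ⟨i, Nat.lt_of_succ_lt hi⟩ ⟨s - i, by omega⟩
      (Or.inl (by simp only; omega))
    have h2 := oddSubdivision_adj_of_add d ⟨i + 1, hi⟩ ⟨s - i, by omega⟩
      (Or.inr (by simp only; omega))
    exact ((ih (Nat.lt_of_succ_lt hi)).concat h1).concat ((G.oddSubdivision s).symm _ _ h2)

theorem hasWalk_subdivPoint_inl {s : ℕ} (d : G.Dart) (i : ℕ) (hi : i < s + 1) :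
    (G.oddSubdivision s).HasWalk (2 * (s - i) + 1) (G.subdivPoint s d ⟨i, hi⟩)
      (Sum.inl d.1.2) := by
  have h1 := oddSubdivision_adj_of_add d ⟨i, hi⟩ ⟨s - i, by omega⟩
    (Or.inl (by simp only; omega))
  exact ⟨_, h1, (hasWalk_inl_subdivPoint d.rev (s - i) (Nat.lt_succ_of_le (Nat.sub_le s i))).reverse⟩

theorem isHom_inl_power_oddSubdivision (G : LoopGraph V) (s : ℕ) :
    G.IsHom ((G.oddSubdivision s).power (2 * s + 1)) Sum.inl :=
  fun u v h => hasWalk_subdivPoint_inl (s := s) ⟨(u, v), h⟩ 0 (Nat.succ_pos s)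

/-- A homomorphism from a loopless graph to the `(2s+1)`-st power of `X` extends to a homomorphism
from the `(2s+1)`-subdivision to `X`: each subdivided edge runs along a walk of `X`. -/
theorem exists_isHom_oddSubdivision {X : LoopGraph W} {s : ℕ} {f : V → W}
    (hG : ∀ v, ¬ G.Adj v v) (hf : G.IsHom (X.power (2 * s + 1)) f) :
    ∃ g : G.SubdivVertex s → W, (∀ v, g (Sum.inl v) = f v) ∧ (G.oddSubdivision s).IsHom X g := by
  classical
  -- The walks chosen for the two orientations of an edge have to be reverses of each other; an
  -- arbitrary linear order of the vertices tells which orientation is chosen first.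
  let _ : LinearOrder V := linearOrderOfSTO WellOrderingRel
  choose p hp0 hp1 hp using fun d : G.Dart => (hf d.1.1 d.1.2 d.2).exists_seq
  let q : G.Dart → ℕ → W := fun d i =>
    if d.1.1 < d.1.2 then p d i else p d.rev (2 * s + 1 - i)
  have hq0 : ∀ d, q d 0 = f d.1.1 := by
    intro d
    by_cases h : d.1.1 < d.1.2
    · simp only [q, if_pos h, hp0]
    · simp only [q, if_neg h, Nat.sub_zero, hp1]
      rfl
  have hqrev : ∀ d : G.Dart, ∀ i ≤ 2 * s + 1, q d.rev i = q d (2 * s + 1 - i) := by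
    intro d i hi
    have hne : d.1.1 ≠ d.1.2 := fun h => hG d.1.1 (by have := d.2; rwa [← h] at this)
    by_cases h : d.1.1 < d.1.2
    · have h' : ¬ d.rev.1.1 < d.rev.1.2 := not_lt.2 h.le
      simp only [q, if_pos h, if_neg h', Dart.rev_rev]
    · have h' : d.rev.1.1 < d.rev.1.2 := lt_of_le_of_ne (not_lt.1 h) hne.symm
      simp only [q, if_neg h, if_pos h']
      congr 1
      omega
  have hq : ∀ d, ∀ i < 2 * s + 1, X.Adj (q d i) (q d (i + 1)) := by
    intro d i hi
    by_cases h : d.1.1 < d.1.2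
    · simp only [q, if_pos h]
      exact hp d i hi
    · simp only [q, if_neg h]
      have := hp d.rev (2 * s + 1 - (i + 1)) (by omega)
      rw [show 2 * s + 1 - (i + 1) + 1 = 2 * s + 1 - i by omega] at this
      exact X.symm _ _ this
  let g : G.SubdivVertex s → W := Sum.elim f fun x => q x.1 (2 * ((x.2 : ℕ) + 1))
  have hg : ∀ (d : G.Dart) (i : Fin (s + 1)), g (G.subdivPoint s d i) = q d (2 * i) := by
    intro d i
    refine Fin.cases ?_ (fun j => ?_) i
    · exact (hq0 d).symm
    · rfl
  refine ⟨g, fun v => rfl, fun x y hxy => ?_⟩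
  obtain ⟨d, i, j, hij, rfl, rfl⟩ := exists_of_oddSubdivision_adj hxy
  rw [hg, hg, hqrev d (2 * j) (by omega)]
  rcases hij with hij | hij
  · rw [show 2 * s + 1 - 2 * (j : ℕ) = 2 * i + 1 by omega]
    exact hq d _ (by omega)
  · have := hq d (2 * s + 1 - 2 * (j : ℕ)) (by omega)
    rw [show 2 * s + 1 - 2 * (j : ℕ) + 1 = 2 * i by omega] at this
    exact X.symm _ _ this

theorem exists_isHom_oddSubdivision_map {X : LoopGraph W} (s : ℕ) {f : V → W}
    (hG : ∀ v, ¬ G.Adj v v) (hf : G.IsHom X f) :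
    ∃ g : G.SubdivVertex s → X.SubdivVertex s, (∀ v, g (Sum.inl v) = Sum.inl (f v)) ∧
      (G.oddSubdivision s).IsHom (X.oddSubdivision s) g :=
  exists_isHom_oddSubdivision hG ((isHom_inl_power_oddSubdivision X s).comp hf)

/-- The end of its edge to which a point of the subdivision is attached: `(uv)_i ↦ u`. -/
def subdivBase (G : LoopGraph V) (s : ℕ) : G.SubdivVertex s → V :=
  Sum.elim id fun x => x.1.1.1

/-- Contracting the subdivided edges to their ends is a homomorphism from the `(2s+1)`-st power of
the `(2s+1)`-subdivision back to the graph. -/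
theorem isHom_subdivBase (G : LoopGraph V) (s : ℕ) :
    ((G.oddSubdivision s).power (2 * s + 1)).IsHom G (G.subdivBase s) := by
  classical
  -- `C r (uv) i` is the set of ends of the points at walk distance `r ≤ s` from `(uv)_i`.
  let C : ℕ → G.Dart → ℕ → Set V := fun r d i =>
    if Even r then (if i + r / 2 ≤ s then {d.1.1} else {z | G.Adj d.1.2 z})
    else (if i ≤ r / 2 then {z | G.Adj d.1.1 z} else {d.1.2})
  let B : ℕ → G.SubdivVertex s → Set V := fun r =>
    Sum.elim (fun u => if Even r then {u} else {z | G.Adj u z}) fun x => C r x.1 ((x.2 : ℕ) + 1)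
  have hB : ∀ r ≤ s, ∀ (d : G.Dart) (i : Fin (s + 1)), B r (G.subdivPoint s d i) = C r d i := by
    intro r hr d i
    refine Fin.cases ?_ (fun j => ?_) i
    · have : 0 + r / 2 ≤ s := by omega
      simp only [subdivPoint_zero, B, C, Sum.elim_inl, Fin.val_zero, if_pos this,
        if_pos (Nat.zero_le _)]
    · rfl
  refine isHom_power_of_balls B ?_ ?_ ?_
  · rintro (u | ⟨d, j⟩)
    · simp [B, subdivBase]
    · have : (j : ℕ) + 1 + 0 / 2 ≤ s := by omega
      simp only [B, subdivBase, Sum.elim_inr, C, Even.zero, if_true, if_pos this]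
      rfl
  · intro r hr x y hxy
    obtain ⟨d, i, j, hij, rfl, rfl⟩ := exists_of_oddSubdivision_adj hxy
    rw [hB r (by omega), hB (r + 1) (by omega)]
    have hd : d.rev.1 = (d.1.2, d.1.1) := rfl
    have hadj := d.2
    have hadj' := G.symm _ _ d.2
    rcases Nat.even_or_odd' r with ⟨N, rfl | rfl⟩
    · have h1 : Even (2 * N) := even_two_mul N
      have h2 : ¬ Even (2 * N + 1) := by simp
      simp only [C, h1, h2, if_true, if_false, hd]
      rw [show 2 * N / 2 = N by omega, show (2 * N + 1) / 2 = N by omega]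
      split_ifs with ha hb hb
      · simpa using hadj'
      · simp
      · exact subset_rfl
      · omega
    · have h1 : ¬ Even (2 * N + 1) := by simp
      have h2 : Even (2 * N + 1 + 1) := ⟨N + 1, by omega⟩
      simp only [C, h1, h2, if_true, if_false, hd]
      rw [show (2 * N + 1) / 2 = N by omega, show (2 * N + 1 + 1) / 2 = N + 1 by omega]
      split_ifs with ha hb hb
      · omega
      · exact subset_rfl
      · simp
      · simpa using hadj
  · intro x y hxy
    obtain ⟨d, i, j, hij, rfl, rfl⟩ := exists_of_oddSubdivision_adj hxy
    rw [hB s le_rfl, hB s le_rfl]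
    have hd : d.rev.1 = (d.1.2, d.1.1) := rfl
    have hadj := d.2
    have hadj' := G.symm _ _ d.2
    rcases Nat.even_or_odd' s with ⟨N, hN⟩
    rcases hN with hN | hN
    · have h1 : Even s := ⟨N, by omega⟩
      simp only [C, h1, if_true, hd]
      have : s / 2 = N := by omega
      rw [this]
      split_ifs with ha hb hb
      · rintro _ rfl _ rfl
        exact hadj
      · rintro _ rfl b hb'
        exact hb'
      · rintro a ha' _ rfl
        exact G.symm _ _ ha'
      · omega
    · have h1 : ¬ Even s := by rw [hN]; simp
      simp only [C, h1, if_false, hd]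
      have : s / 2 = N := by omega
      rw [this]
      split_ifs with ha hb hb
      · omega
      · rintro a ha' _ rfl
        exact G.symm _ _ ha'
      · rintro _ rfl b hb'
        exact hb'
      · rintro _ rfl _ rfl
        exact hadj'

end Subdivision

theorem chromaticNumber_le_iff {V : Type*} {G : LoopGraph V} {n : ℕ} :
    G.chromaticNumber ≤ n ↔ G.Colorable n := by
  constructor
  · intro h
    by_contra hn
    have hlt : ((n + 1 : ℕ) : ℕ∞) ≤ G.chromaticNumber := by
      refine le_iInf₂ fun k hk => ?_
      by_contra hlt
      have hkn : k < n + 1 := by exact_mod_cast not_le.1 hlt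
      exact hn (Colorable.mono hk (by omega))
    have : ((n + 1 : ℕ) : ℕ∞) ≤ (n : ℕ) := hlt.trans h
    have : n + 1 ≤ n := by exact_mod_cast this
    omega
  · exact fun h => iInf₂_le n h

end LoopGraph

/-! ### The lemmas of Fan and Tucker -/

section Alternation

/-- The signs of the elements of `S`, listed by increasing absolute value, alternate; the first
one is `+` if `σ` is even and `-` if `σ` is odd. -/
def AlternatesFrom (σ : ℕ) (S : Finset ℤ) : Prop :=
  ∀ a ∈ S, (0 < a ↔ Even (σ + (S.filter fun b => |b| < |a|).card))

open Classical in
/-- The indicator function of `AlternatesFrom σ`, with values mod 2. -/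
noncomputable def alternatesInd (σ : ℕ) (S : Finset ℤ) : ZMod 2 :=
  if AlternatesFrom σ S then 1 else 0

theorem alternatesFrom_insert {σ : ℕ} {a : ℤ} {S : Finset ℤ} (ha : ∀ x ∈ S, |x| < |a|) :
    AlternatesFrom σ (insert a S) ↔ AlternatesFrom σ S ∧ (0 < a ↔ Even (σ + S.card)) := by
  have h1 : (insert a S).filter (fun b => |b| < |a|) = S := by
    rw [Finset.filter_insert, if_neg (lt_irrefl _), Finset.filter_true_of_mem ha]
  have h2 : ∀ x ∈ S, (insert a S).filter (fun b => |b| < |x|) = S.filter fun b => |b| < |x| := by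
    intro x hx
    rw [Finset.filter_insert, if_neg (not_lt.2 (ha x hx).le)]
  unfold AlternatesFrom
  rw [Finset.forall_mem_insert, h1, and_comm]
  exact and_congr_left' (forall₂_congr fun x hx => by rw [h2 x hx])

theorem alternatesInd_insert {σ : ℕ} {a : ℤ} {S : Finset ℤ} (ha : ∀ x ∈ S, |x| < |a|) :
    alternatesInd σ (insert a S) =
      (if (0 < a ↔ Even (σ + S.card)) then 1 else 0) * alternatesInd σ S := by
  classical
  unfold alternatesInd
  rw [ite_zero_mul_ite_zero, mul_one]
  exact if_congr ((alternatesFrom_insert ha).trans and_comm) rfl rfl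

/-- Mod 2, the coboundary of the cochain of alternating simplices that start with `+` is the
cochain of alternating simplices: `S` has an odd number of facets of the first kind iff it is
alternating itself. -/
theorem sum_alternatesInd_erase (S : Finset ℤ) (hS : ∀ a ∈ S, ∀ b ∈ S, a ≠ -b) :
    ∑ a ∈ S, alternatesInd 0 (S.erase a) = alternatesInd 0 S + alternatesInd 1 S := by
  classical
  induction S using Finset.induction_on_max_value (fun a : ℤ => |a|) with
  | empty => simp [alternatesInd, AlternatesFrom]; decide
  | insert a S haS hmax ih =>
    have hlt : ∀ x ∈ S, |x| < |a| := by
      intro x hx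
      refine lt_of_le_of_ne (hmax x hx) fun h => ?_
      rcases abs_eq_abs.1 h with h | h
      · exact haS (h ▸ hx)
      · exact hS x (Finset.mem_insert_of_mem hx) a (Finset.mem_insert_self _ _) h
    have ih := ih fun x hx y hy =>
      hS x (Finset.mem_insert_of_mem hx) y (Finset.mem_insert_of_mem hy)
    rw [Finset.sum_insert haS, Finset.erase_insert haS, alternatesInd_insert hlt,
      alternatesInd_insert hlt]
    have hface : ∀ x ∈ S, alternatesInd 0 ((insert a S).erase x) =
        (if (0 < a ↔ Even (1 + S.card)) then 1 else 0) * alternatesInd 0 (S.erase x) := by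
      intro x hx
      rw [Finset.erase_insert_of_ne (ne_of_mem_of_not_mem hx haS).symm,
        alternatesInd_insert fun y hy => hlt y (Finset.mem_of_mem_erase hy),
        Finset.card_erase_of_mem hx]
      have : 0 < S.card := Finset.card_pos.2 ⟨x, hx⟩
      have : Even (0 + (S.card - 1)) ↔ Even (1 + S.card) := by
        rw [show 1 + S.card = (0 + (S.card - 1)) + 2 by omega, Nat.even_add (n := 2)]
        simp
      simp only [this]
    rw [Finset.sum_congr rfl hface, ← Finset.mul_sum, ih]
    have hpar : Even (1 + S.card) ↔ ¬ Even (0 + S.card) := by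
      rw [Nat.zero_add, Nat.add_comm, Nat.even_add_one]
    simp only [hpar]
    have h2 : ∀ t : ZMod 2, t + t = 0 := by decide
    by_cases h0 : (0 < a) <;> by_cases h1 : Even (0 + S.card)
    all_goals
      simp only [h0, h1]
      simp
    all_goals
      linear_combination h2 (alternatesInd 0 S)

open Classical in
/-- The indicator, mod 2, of the tuples of labels that are pairwise distinct in absolute value and
alternating, starting with `+`. -/
noncomputable def altTuple {n : ℕ} (l : Fin n → ℤ) : ZMod 2 :=
  if Function.Injective l then alternatesInd 0 (Finset.univ.image l) else 0

theorem altTuple_neg {n : ℕ} {l : Fin n → ℤ} (hl : ∀ i j, l i ≠ -l j) :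
    altTuple (-l) =
      open Classical in if Function.Injective l then alternatesInd 1 (Finset.univ.image l) else 0 := by
  classical
  unfold altTuple
  have hinj : Function.Injective (-l) ↔ Function.Injective l := by
    constructor
    · exact fun h i j hij => h (by simp [hij])
    · exact fun h i j hij => h (neg_injective hij)
  simp only [hinj]
  refine if_congr Iff.rfl ?_ rfl
  unfold alternatesInd
  refine if_congr ?_ rfl rfl
  have himg : Finset.univ.image (-l) = (Finset.univ.image l).image fun a => -a := by
    rw [Finset.image_image]
    rfl
  unfold AlternatesFrom
  rw [himg, Finset.forall_mem_image]
  refine forall₂_congr fun a ha => ?_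
  have hcard : (((Finset.univ.image l).image fun a => -a).filter fun b => |b| < |-a|).card =
      ((Finset.univ.image l).filter fun b => |b| < |a|).card := by
    rw [Finset.filter_image, Finset.card_image_of_injective _ neg_injective]
    simp only [abs_neg]
  rw [hcard, Nat.add_comm 1, Nat.even_add_one, Nat.zero_add]
  have ha0 : a ≠ 0 := by
    obtain ⟨i, -, rfl⟩ := Finset.mem_image.1 ha
    intro h
    exact hl i i (by rw [h]; rfl)
  have : 0 < -a ↔ ¬ 0 < a := by omega
  rw [this]
  tauto

theorem sum_altTuple_succAbove {n : ℕ} {l : Fin (n + 1) → ℤ} (hl : ∀ i j, l i ≠ -l j) :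
    ∑ i, altTuple (l ∘ Fin.succAbove i) = altTuple l + altTuple (-l) := by
  classical
  have himg : ∀ i : Fin (n + 1),
      Finset.univ.image (l ∘ Fin.succAbove i) = (Finset.univ.erase i).image l := by
    intro i
    rw [← Finset.image_image]
    congr 1
    ext j
    simp only [Finset.mem_image, Finset.mem_univ, true_and, Finset.mem_erase, and_true]
    exact Fin.exists_succAbove_eq_iff
  rw [altTuple_neg hl]
  by_cases hinj : Function.Injective l
  · rw [if_pos hinj]
    unfold altTuple
    rw [if_pos hinj, ← sum_alternatesInd_erase, Finset.sum_image fun i _ j _ h => hinj h]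
    · refine Finset.sum_congr rfl fun i _ => ?_
      rw [if_pos (hinj.comp (Fin.succAbove_right_injective)), himg,
        Finset.image_erase hinj]
    · intro a ha b hb
      obtain ⟨i, -, rfl⟩ := Finset.mem_image.1 ha
      obtain ⟨j, -, rfl⟩ := Finset.mem_image.1 hb
      exact hl i j
  · rw [if_neg hinj]
    unfold altTuple
    rw [if_neg hinj, add_zero]
    -- If `l a = l b` with `a ≠ b`, only the facets opposite to `a` and `b` can have distinct
    -- labels, and these two facets have the same labels.
    obtain ⟨a, b, hab, hne⟩ : ∃ a b, l a = l b ∧ a ≠ b := by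
      simpa [Function.Injective] using hinj
    have hzero : ∀ i, i ≠ a → i ≠ b → ¬ Function.Injective (l ∘ Fin.succAbove i) := by
      intro i hia hib h
      obtain ⟨x, hx⟩ := Fin.exists_succAbove_eq hia.symm
      obtain ⟨y, hy⟩ := Fin.exists_succAbove_eq hib.symm
      have : x = y := h (by simp [hx, hy, hab])
      exact hne (by rw [← hx, ← hy, this])
    rw [Finset.sum_eq_add a b hne]
    · have hsame : (Finset.univ.erase a).image l = (Finset.univ.erase b).image l := by
        have : ∀ a b : Fin (n + 1), l a = l b → a ≠ b →
            (Finset.univ.erase a).image l ⊆ (Finset.univ.erase b).image l := by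
          intro a b hab hne y hy
          obtain ⟨i, hi, rfl⟩ := Finset.mem_image.1 hy
          by_cases hib : i = b
          · exact Finset.mem_image.2 ⟨a, by simpa using hne, by rw [hib, hab]⟩
          · exact Finset.mem_image.2 ⟨i, by simpa using hib, rfl⟩
        exact (this a b hab hne).antisymm (this b a hab.symm hne.symm)
      have hcard : ∀ i, Function.Injective (l ∘ Fin.succAbove i) ↔
          ((Finset.univ.erase i).image l).card = n := by
        intro i
        have := Finset.card_image_iff (s := Finset.univ) (f := l ∘ Fin.succAbove i)
        rw [Finset.coe_univ, Set.injOn_univ, Finset.card_univ, Fintype.card_fin] at this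
        rw [← himg, this]
      simp only [himg, hcard, hsame]
      split_ifs
      · have h2 : ∀ t : ZMod 2, t + t = 0 := by decide
        exact h2 _
      · exact add_zero _
    · intro i _ hi
      rw [if_neg (hzero i hi.1 hi.2)]
    · simp
    · simp

end Alternation

section Tucker

/-- The sign vector `x` is a face of the sign vector `y`: `y` is obtained from `x` by changing some
of the coordinates that are `0`. -/
def SignLE {n : ℕ} (x y : Fin n → ℤ) : Prop := ∀ c, x c ≠ 0 → y c = x c

/-- The maximal chain of sign vectors in which the final vector is `ε` and the coordinate `c`
becomes nonzero at position `ρ c`, counted from the top: the vector at position `0` is `ε`. -/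
def signChain {n : ℕ} (ρ : Equiv.Perm (Fin n)) (ε : Fin n → ℤˣ) (i : Fin n) : Fin n → ℤ :=
  fun c => if i ≤ ρ c then (ε c : ℤ) else 0

variable {n : ℕ}

theorem signChain_ne_zero (ρ : Equiv.Perm (Fin n)) (ε : Fin n → ℤˣ) (i : Fin n) :
    signChain ρ ε i ≠ 0 := by
  intro h
  have := congrFun h (ρ.symm i)
  simp [signChain] at this

theorem signChain_signLE (ρ : Equiv.Perm (Fin n)) (ε : Fin n → ℤˣ) {i j : Fin n} (hij : i ≤ j) :
    SignLE (signChain ρ ε j) (signChain ρ ε i) := by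
  intro c hc
  have h : j ≤ ρ c := by
    by_contra h
    exact hc (if_neg h)
  simp only [signChain, if_pos h, if_pos (hij.trans h)]

theorem signChain_neg (ρ : Equiv.Perm (Fin n)) (ε : Fin n → ℤˣ) (i : Fin n) :
    signChain ρ (-ε) i = -signChain ρ ε i := by
  ext c
  simp only [signChain, Pi.neg_apply, Units.val_neg]
  split_ifs <;> simp

/-- A labelling of the sign vectors to which Fan's and Tucker's lemmas apply: it is odd, and
comparable nonzero vectors do not get opposite labels. -/
structure IsFanLabelling (lab : (Fin n → ℤ) → ℤ) : Prop where
  neg : ∀ x, lab (-x) = -lab x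
  ne_neg : ∀ x y, x ≠ 0 → SignLE x y → lab x ≠ -lab y

theorem IsFanLabelling.signChain_ne_neg {lab : (Fin n → ℤ) → ℤ} (h : IsFanLabelling lab)
    (ρ : Equiv.Perm (Fin n)) (ε : Fin n → ℤˣ) (i j : Fin n) :
    lab (signChain ρ ε i) ≠ -lab (signChain ρ ε j) := by
  rcases le_total i j with hij | hij
  · intro he
    exact h.ne_neg _ _ (signChain_ne_zero ρ ε j) (signChain_signLE ρ ε hij) (by rw [he, neg_neg])
  · exact h.ne_neg _ _ (signChain_ne_zero ρ ε i) (signChain_signLE ρ ε hij)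

theorem IsFanLabelling.cons_zero {lab : (Fin (n + 1) → ℤ) → ℤ} (h : IsFanLabelling lab) :
    IsFanLabelling fun x : Fin n → ℤ => lab (Fin.cons 0 x) where
  neg x := by
    rw [← h.neg]
    congr 1
    ext c
    refine Fin.cases ?_ (fun c => ?_) c <;> simp
  ne_neg x y hx hxy := by
    refine h.ne_neg _ _ (fun h0 => hx ?_) fun c => ?_
    · ext c
      have := congrFun h0 c.succ
      simpa using this
    · refine Fin.cases ?_ (fun c => ?_) c
      · simp
      · simpa using hxy c

theorem sum_units_cons {M : Type*} [AddCommMonoid M] (f : (Fin (n + 1) → ℤˣ) → M) :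
    ∑ ε, f ε = ∑ ε : Fin n → ℤˣ, (f (Fin.cons 1 ε) + f (-(Fin.cons 1 ε : Fin (n + 1) → ℤˣ))) := by
  have huniv : (Finset.univ : Finset ℤˣ) = {1, -1} := rfl
  rw [← (Fin.consEquiv fun _ : Fin (n + 1) => ℤˣ).sum_comp, Fintype.sum_prod_type, huniv,
    Finset.sum_pair (by decide), Finset.sum_add_distrib]
  congr 1
  rw [← Equiv.sum_comp (Equiv.neg (Fin n → ℤˣ))]
  refine Finset.sum_congr rfl fun ε _ => congrArg f ?_
  ext c
  refine Fin.cases ?_ (fun c => ?_) c <;> simp [Fin.consEquiv]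

theorem signChain_swap_mul (ρ : Equiv.Perm (Fin (n + 1))) (ε : Fin (n + 1) → ℤˣ) (j : Fin n)
    {i : Fin (n + 1)} (hi : i ≠ j.succ) :
    signChain (Equiv.swap j.castSucc j.succ * ρ) ε i = signChain ρ ε i := by
  ext c
  have hiff : i ≤ Equiv.swap j.castSucc j.succ (ρ c) ↔ i ≤ ρ c := by
    have hi' : (i : ℕ) ≠ j + 1 := fun h => hi (Fin.ext h)
    rw [Equiv.swap_apply_def]
    split_ifs with h1 h2
    · rw [h1, Fin.le_def, Fin.le_def, Fin.val_succ, Fin.val_castSucc]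
      omega
    · rw [h2, Fin.le_def, Fin.le_def, Fin.val_succ, Fin.val_castSucc]
      omega
    · rfl
  simp only [signChain, Equiv.Perm.mul_apply, hiff]

theorem signChain_cons_update (ρ : Equiv.Perm (Fin (n + 1))) (ε : Fin n → ℤˣ) {c : Fin n}
    (hc : ρ c.succ = 0) (a : ℤˣ) (j : Fin n) :
    signChain ρ (Fin.cons 1 (Function.update ε c a) : Fin (n + 1) → ℤˣ) j.succ =
      signChain ρ (Fin.cons 1 ε : Fin (n + 1) → ℤˣ) j.succ := by
  ext d
  refine Fin.cases (by simp [signChain]) (fun d => ?_) d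
  by_cases h : d = c
  · subst h
    simp [signChain, hc]
  · simp [signChain, Function.update_of_ne h]

theorem signChain_decomposeFin (e : Equiv.Perm (Fin n)) (ε : Fin n → ℤˣ) (j : Fin n) :
    signChain (Equiv.Perm.decomposeFin.symm (0, e)) (Fin.cons 1 ε : Fin (n + 1) → ℤˣ) j.succ =
      Fin.cons 0 (signChain e ε j) := by
  ext d
  refine Fin.cases ?_ (fun d => ?_) d
  · simp [signChain]
  · simp [signChain, Equiv.Perm.decomposeFin_symm_apply_succ]

/-- **Fan's lemma** for the boundary of the cross-polytope: the number of maximal chains of sign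
vectors whose labels alternate, starting with `+`, is odd. -/
theorem sum_altTuple_signChain {n : ℕ} {lab : (Fin n → ℤ) → ℤ} (h : IsFanLabelling lab) :
    ∑ ρ : Equiv.Perm (Fin n), ∑ ε : Fin n → ℤˣ, altTuple (fun i => lab (signChain ρ ε i)) = 1 := by
  classical
  have h2 : ∀ t : ZMod 2, t + t = 0 := by decide
  induction n with
  | zero =>
    simp [altTuple, Function.injective_of_subsingleton, alternatesInd, AlternatesFrom]
  | succ n ih =>
    -- The chains `cons 1 ε` are those in the hemisphere where coordinate `0` is nonnegative; the
    -- antipodal chain alternates from `+` iff the chain itself alternates from `-`, so that the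
    -- number we want is the number of alternating facets of the chains in the hemisphere.
    have hsplit : ∀ ρ : Equiv.Perm (Fin (n + 1)),
        ∑ ε : Fin (n + 1) → ℤˣ, altTuple (fun i => lab (signChain ρ ε i)) =
        ∑ ε : Fin n → ℤˣ, ∑ i : Fin (n + 1),
          altTuple ((fun i => lab (signChain ρ (Fin.cons 1 ε : Fin (n + 1) → ℤˣ) i)) ∘
            Fin.succAbove i) := by
      intro ρ
      rw [sum_units_cons]
      refine Finset.sum_congr rfl fun ε _ => ?_
      rw [sum_altTuple_succAbove fun i j => h.signChain_ne_neg ρ _ i j]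
      congr 2
      ext i
      rw [signChain_neg, h.neg]
      rfl
    rw [Finset.sum_congr rfl fun ρ _ => hsplit ρ, Finset.sum_comm]
    simp only [Fin.sum_univ_succ, Finset.sum_add_distrib]
    -- Facets that omit an inner vector of the chain: exchange the two coordinates added there.
    have hswap : ∀ ε : Fin n → ℤˣ, ∑ ρ : Equiv.Perm (Fin (n + 1)), ∑ j : Fin n,
        altTuple ((fun i => lab (signChain ρ (Fin.cons 1 ε : Fin (n + 1) → ℤˣ) i)) ∘
          Fin.succAbove j.succ) = 0 := by
      intro ε
      rw [Finset.sum_comm]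
      refine Finset.sum_eq_zero fun j _ => ?_
      refine Finset.sum_ninvolution (fun ρ => Equiv.swap j.castSucc j.succ * ρ) ?_ ?_ ?_ ?_
      · intro ρ
        have : (fun i => lab (signChain (Equiv.swap j.castSucc j.succ * ρ)
            (Fin.cons 1 ε : Fin (n + 1) → ℤˣ) i)) ∘ Fin.succAbove j.succ =
            (fun i => lab (signChain ρ (Fin.cons 1 ε : Fin (n + 1) → ℤˣ) i)) ∘
              Fin.succAbove j.succ := by
          ext i
          simp only [Function.comp_apply]
          rw [signChain_swap_mul _ _ _ (Fin.succAbove_ne _ _)]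
        rw [this, h2]
      · intro ρ _ he
        have := mul_eq_right.1 he
        rw [Equiv.swap_eq_one_iff] at this
        exact absurd this (Fin.castSucc_lt_succ).ne
      · simp
      · intro ρ
        rw [← mul_assoc, Equiv.swap_mul_self, one_mul]
    rw [Finset.sum_congr rfl fun ε _ => hswap ε, Finset.sum_const_zero, add_zero, Finset.sum_comm,
      ← Equiv.Perm.decomposeFin.symm.sum_comp, Fintype.sum_prod_type, Fin.sum_univ_succ]
    -- Facets that omit the full vector: change the sign of the coordinate added last, if this is
    -- not coordinate `0`.
    have hflip : ∀ (p : Fin n) (e : Equiv.Perm (Fin n)), ∑ ε : Fin n → ℤˣ,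
        altTuple ((fun i => lab (signChain (Equiv.Perm.decomposeFin.symm (p.succ, e))
          (Fin.cons 1 ε : Fin (n + 1) → ℤˣ) i)) ∘ Fin.succAbove 0) = 0 := by
      intro p e
      set ρ := Equiv.Perm.decomposeFin.symm (p.succ, e) with hρ
      obtain ⟨c, hc⟩ : ∃ c : Fin n, ρ c.succ = 0 := by
        obtain ⟨d, hd⟩ := ρ.surjective 0
        have hd0 : d ≠ 0 := by
          rintro rfl
          rw [hρ, Equiv.Perm.decomposeFin_symm_apply_zero] at hd
          exact Fin.succ_ne_zero _ hd
        obtain ⟨c, rfl⟩ := Fin.exists_succ_eq.2 hd0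
        exact ⟨c, hd⟩
      refine Finset.sum_ninvolution (fun ε => Function.update ε c (-ε c)) ?_ ?_ ?_ ?_
      · intro ε
        have : (fun i => lab (signChain ρ
            (Fin.cons 1 (Function.update ε c (-ε c)) : Fin (n + 1) → ℤˣ) i)) ∘ Fin.succAbove 0 =
            (fun i => lab (signChain ρ (Fin.cons 1 ε : Fin (n + 1) → ℤˣ) i)) ∘
              Fin.succAbove 0 := by
          ext i
          simp only [Function.comp_apply, Fin.succAbove_zero]
          rw [signChain_cons_update _ _ hc]
        rw [this, h2]
      · intro ε _ he
        have h3 := congrFun he c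
        rw [Function.update_self] at h3
        exact absurd h3 (by rcases Int.units_eq_one_or (ε c) with h | h <;> rw [h] <;> decide)
      · simp
      · intro ε
        simp
    have hzero : ∑ p : Fin n, ∑ e : Equiv.Perm (Fin n), ∑ ε : Fin n → ℤˣ,
        altTuple ((fun i => lab (signChain (Equiv.Perm.decomposeFin.symm (p.succ, e))
          (Fin.cons 1 ε : Fin (n + 1) → ℤˣ) i)) ∘ Fin.succAbove 0) = 0 :=
      Finset.sum_eq_zero fun p _ => Finset.sum_eq_zero fun e _ => hflip p e
    rw [hzero, add_zero, ← ih h.cons_zero]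
    refine Finset.sum_congr rfl fun e _ => Finset.sum_congr rfl fun ε _ => congrArg altTuple ?_
    ext j
    simp only [Function.comp_apply, Fin.succAbove_zero, signChain_decomposeFin]

/-- **Tucker's lemma** for the boundary of the cross-polytope. -/
theorem IsFanLabelling.exists_le_abs {lab : (Fin n → ℤ) → ℤ} (h : IsFanLabelling lab)
    (hn : 0 < n) : ∃ x, x ≠ 0 ∧ (n : ℤ) ≤ |lab x| := by
  classical
  by_contra! hlt
  obtain ⟨ρ, -, hρ⟩ := Finset.exists_ne_zero_of_sum_ne_zero
    ((sum_altTuple_signChain h).trans_ne one_ne_zero)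
  obtain ⟨ε, -, hε⟩ := Finset.exists_ne_zero_of_sum_ne_zero hρ
  have hinj : Function.Injective fun i => lab (signChain ρ ε i) := by
    by_contra hinj
    exact hε (if_neg hinj)
  have hne := h.signChain_ne_neg ρ ε
  have hmaps : ∀ i ∈ (Finset.univ : Finset (Fin n)),
      (lab (signChain ρ ε i)).natAbs ∈ Finset.Ico 1 n := by
    intro i _
    have h1 := hlt _ (signChain_ne_zero ρ ε i)
    have h2 := hne i i
    rw [Int.abs_eq_natAbs] at h1
    rw [Finset.mem_Ico]
    omega
  obtain ⟨i, -, j, -, hij, he⟩ := Finset.exists_ne_map_eq_of_card_lt_of_maps_to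
    (by rw [Nat.card_Ico, Finset.card_univ, Fintype.card_fin]; omega) hmaps
  rcases Int.natAbs_eq_natAbs_iff.1 he with he | he
  · exact hij (hinj he)
  · exact hne i j he

end Tucker

/-! ### The lower bound for Schrijver-type graphs -/

section AlternationNumber

variable {n : ℕ}

/-- The sign vector `x` has an alternating subsequence of length `L` that starts with `+`. -/
def HasAlternating (x : Fin n → ℤ) (L : ℕ) : Prop :=
  ∃ f : Fin L → Fin n, StrictMono f ∧ ∀ i : Fin L, 0 < (-1) ^ (i : ℕ) * x (f i)

theorem HasAlternating.le {x : Fin n → ℤ} {L : ℕ} (h : HasAlternating x L) : L ≤ n := by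
  obtain ⟨f, hf, -⟩ := h
  simpa using Fintype.card_le_of_injective f hf.injective

theorem hasAlternating_zero (x : Fin n → ℤ) : HasAlternating x 0 :=
  ⟨Fin.elim0, fun i => i.elim0, fun i => i.elim0⟩

theorem HasAlternating.mono {x y : Fin n → ℤ} (hxy : SignLE x y) {L : ℕ}
    (h : HasAlternating x L) : HasAlternating y L := by
  obtain ⟨f, hf, hx⟩ := h
  refine ⟨f, hf, fun i => ?_⟩
  rw [hxy (f i) fun h0 => by simpa [h0] using hx i]
  exact hx i

open Classical in
/-- The largest length of an alternating subsequence of `x` that starts with `+`. -/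
noncomputable def altNumber (x : Fin n → ℤ) : ℕ :=
  Nat.findGreatest (HasAlternating x) n

theorem hasAlternating_altNumber (x : Fin n → ℤ) : HasAlternating x (altNumber x) := by
  classical
  exact Nat.findGreatest_spec (P := HasAlternating x) (Nat.zero_le n) (hasAlternating_zero x)

theorem HasAlternating.le_altNumber {x : Fin n → ℤ} {L : ℕ} (h : HasAlternating x L) :
    L ≤ altNumber x := by
  classical
  exact Nat.le_findGreatest h.le h

theorem altNumber_mono {x y : Fin n → ℤ} (hxy : SignLE x y) : altNumber x ≤ altNumber y :=
  ((hasAlternating_altNumber x).mono hxy).le_altNumber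

theorem SignLE.neg {x y : Fin n → ℤ} (h : SignLE x y) : SignLE (-x) (-y) := by
  intro c hc
  simp only [Pi.neg_apply] at hc ⊢
  rw [h c (by simpa using hc)]

/-- An alternating subsequence that starts with `-` can be extended by an earlier `+`. -/
theorem HasAlternating.cons {x : Fin n → ℤ} {L : ℕ} {c : Fin n} (hc : 0 < x c)
    {f : Fin L → Fin n} (hf : StrictMono f) (hx : ∀ i : Fin L, 0 < (-1) ^ (i : ℕ) * (-x) (f i))
    (hcf : ∀ i, c < f i) : HasAlternating x (L + 1) := by
  refine ⟨Fin.cons c f, ?_, ?_⟩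
  · intro i j hij
    induction i using Fin.cases with
    | zero =>
      induction j using Fin.cases with
      | zero => exact absurd hij (lt_irrefl _)
      | succ j => simpa using hcf j
    | succ i =>
      induction j using Fin.cases with
      | zero => exact absurd hij (Fin.not_lt_zero _)
      | succ j => simpa using hf (Fin.succ_lt_succ_iff.1 hij)
  · intro i
    refine Fin.cases ?_ (fun i => ?_) i
    · simpa using hc
    · have := hx i
      simp only [Fin.cons_succ, Fin.val_succ, pow_succ]
      simpa using this

/-- The longest alternating subsequences of a nonzero sign vector all start with the same sign. -/
theorem altNumber_ne_neg {x : Fin n → ℤ} (hx : x ≠ 0) : altNumber x ≠ altNumber (-x) := by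
  intro he
  obtain ⟨f, hf, hfx⟩ := hasAlternating_altNumber x
  obtain ⟨g, hg, hgx⟩ := hasAlternating_altNumber (-x)
  obtain ⟨c, hc⟩ : ∃ c, x c ≠ 0 := by
    by_contra! h
    exact hx (funext h)
  have hpos : 0 < altNumber x := by
    have key : ∀ y : Fin n → ℤ, 0 < y c → 0 < altNumber y := fun y hy =>
      HasAlternating.le_altNumber (L := 1) ⟨fun _ => c, Subsingleton.strictMono _, fun i => by
        simpa [Fin.fin_one_eq_zero i] using hy⟩
    rcases lt_or_gt_of_ne hc with h | h
    · rw [he]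
      exact key (-x) (by simpa using h)
    · exact key x h
  have hpos' : 0 < altNumber (-x) := he ▸ hpos
  have hf0 : 0 < x (f ⟨0, hpos⟩) := by simpa using hfx ⟨0, hpos⟩
  have hg0 : 0 < (-x) (g ⟨0, hpos'⟩) := by simpa using hgx ⟨0, hpos'⟩
  rcases lt_trichotomy (f ⟨0, hpos⟩) (g ⟨0, hpos'⟩) with h | h | h
  · have := (HasAlternating.cons hf0 hg hgx fun i =>
      h.trans_le (hg.monotone (Fin.mk_le_of_le_val (Nat.zero_le _)))).le_altNumber
    omega
  · rw [h] at hf0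
    simp only [Pi.neg_apply] at hg0
    omega
  · have := (HasAlternating.cons (x := -x) hg0 hf (by simpa using hfx) fun i =>
      h.trans_le (hf.monotone (Fin.mk_le_of_le_val (Nat.zero_le _)))).le_altNumber
    omega

end AlternationNumber

section StableSets

/-- A set of natural numbers without two consecutive elements. -/
def IsStable (A : Finset ℕ) : Prop := ∀ i ∈ A, i + 1 ∉ A

/-- The graph whose vertices are the stable subsets of `{0, …, n-1}` with at least `K` elements;
disjoint sets are adjacent. (It differs from a Schrijver graph in that `0` and `n-1` may both
belong to a vertex.) -/
def stableKneser (n K : ℕ) :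
    LoopGraph {A : Finset ℕ // A ⊆ Finset.range n ∧ IsStable A ∧ K ≤ A.card} where
  Adj A B := Disjoint A.1 B.1
  symm _ _ h := h.symm

variable {n : ℕ}

/-- The coordinates where the sign vector `x` is positive. -/
def posSupport (x : Fin n → ℤ) : Set ℕ := {q | ∃ h : q < n, 0 < x ⟨q, h⟩}

theorem posSupport_mono {x y : Fin n → ℤ} (h : SignLE x y) : posSupport x ⊆ posSupport y := by
  rintro q ⟨hq, hx⟩
  refine ⟨hq, ?_⟩
  rw [h _ hx.ne']
  exact hx

theorem not_mem_posSupport_neg {x : Fin n → ℤ} {q : ℕ} (h : q ∈ posSupport x) :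
    q ∉ posSupport (-x) := by
  rintro ⟨hq, h'⟩
  obtain ⟨hq', h⟩ := h
  simp only [Pi.neg_apply] at h'
  omega

/-- The elements of one parity class of a long alternating subsequence form a stable set, because
there are elements of the other class between them. -/
theorem exists_stable_of_strictMono {x : Fin n → ℤ} {K L o : ℕ} {f : Fin L → Fin n}
    (hf : StrictMono f) (ho : o < 2) (hL : 2 * K ≤ L)
    (hx : ∀ i : Fin L, (i : ℕ) % 2 = o → 0 < x (f i)) :
    ∃ A : Finset ℕ, (A ⊆ Finset.range n ∧ IsStable A ∧ K ≤ A.card) ∧ ↑A ⊆ posSupport x := by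
  let g : Fin K → ℕ := fun i => f ⟨2 * i + o, by omega⟩
  have hg : StrictMono g := fun i j hij => hf (by
    rw [Fin.lt_def] at hij ⊢
    simp only
    omega)
  refine ⟨Finset.univ.image g, ⟨?_, ?_, ?_⟩, ?_⟩
  · intro q hq
    obtain ⟨i, -, rfl⟩ := Finset.mem_image.1 hq
    exact Finset.mem_range.2 (Fin.is_lt _)
  · intro q hq hq'
    obtain ⟨i, -, rfl⟩ := Finset.mem_image.1 hq
    obtain ⟨j, -, hj⟩ := Finset.mem_image.1 hq'
    have hij : i < j := hg.lt_iff_lt.1 (by omega)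
    have h1 : f ⟨2 * i + o, by omega⟩ < f ⟨2 * i + o + 1, by omega⟩ := hf (by
      rw [Fin.lt_def]
      simp only
      omega)
    have h2 : f ⟨2 * i + o + 1, by omega⟩ < f ⟨2 * j + o, by omega⟩ := hf (by
      rw [Fin.lt_def] at hij ⊢
      simp only
      omega)
    rw [Fin.lt_def] at h1 h2
    simp only [g] at hj
    omega
  · rw [Finset.card_image_of_injective _ hg.injective, Finset.card_univ, Fintype.card_fin]
  · intro q hq
    obtain ⟨i, -, rfl⟩ := Finset.mem_image.1 (Finset.mem_coe.1 hq)
    exact ⟨Fin.is_lt _, hx _ (by simp only; omega)⟩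

theorem exists_stable_of_le_altNumber {x : Fin n → ℤ} {K : ℕ}
    (h : 2 * K ≤ max (altNumber x) (altNumber (-x))) :
    ∃ A : Finset ℕ, (A ⊆ Finset.range n ∧ IsStable A ∧ K ≤ A.card) ∧ ↑A ⊆ posSupport x := by
  rcases le_max_iff.1 h with h | h
  · obtain ⟨f, hf, hx⟩ := hasAlternating_altNumber x
    refine exists_stable_of_strictMono (o := 0) hf (by omega) h fun i hi => ?_
    have := hx i
    rwa [Even.neg_one_pow (Nat.even_iff.2 hi), one_mul] at this
  · obtain ⟨f, hf, hx⟩ := hasAlternating_altNumber (-x)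
    refine exists_stable_of_strictMono (o := 1) hf (by omega) h fun i hi => ?_
    have := hx i
    rw [Odd.neg_one_pow (Nat.odd_iff.2 hi)] at this
    simpa using this

/-- The lower bound for the chromatic number of Schrijver graphs. -/
theorem lt_of_stableKneser_colorable {K C : ℕ} (hK : 0 < K) (hn : 2 * K ≤ n)
    (hc : (stableKneser n K).Colorable C) : n + 1 < 2 * K + C := by
  classical
  obtain ⟨c, hc⟩ := hc
  by_contra! hlt
  -- `F x` is the set of colours of the vertices contained in the positive support of `x`.
  let F : (Fin n → ℤ) → Set ℕ := fun x => {a | ∃ A, ↑A.1 ⊆ posSupport x ∧ (c A : ℕ) = a}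
  have hFmono : ∀ x y, SignLE x y → F x ⊆ F y := by
    rintro x y hxy _ ⟨A, hA, rfl⟩
    exact ⟨A, hA.trans (posSupport_mono hxy), rfl⟩
  have hFneg : ∀ x, ∀ a ∈ F x, a ∉ F (-x) := by
    rintro x _ ⟨A, hA, rfl⟩ ⟨B, hB, he⟩
    refine hc A B ?_ (Fin.ext he.symm)
    exact Finset.disjoint_left.2 fun q hqA hqB => not_mem_posSupport_neg (hA hqA) (hB hqB)
  have hFlt : ∀ x, ∀ a ∈ F x, a < C := by
    rintro x _ ⟨A, -, rfl⟩
    exact Fin.is_lt _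
  let N : (Fin n → ℤ) → ℕ := fun x => max (altNumber x) (altNumber (-x))
  have hNneg : ∀ x, N (-x) = N x := fun x => by simp only [N, neg_neg, max_comm]
  have hFne : ∀ x, 2 * K ≤ N x → (F x).Nonempty := by
    intro x hx
    obtain ⟨A, hA, hAx⟩ := exists_stable_of_le_altNumber hx
    exact ⟨_, ⟨A, hA⟩, hAx, rfl⟩
  have hmin : ∀ x, 2 * K ≤ N x → sInf (F x) ∈ F x := fun x hx => Nat.sInf_mem (hFne x hx)
  have hmin_ne : ∀ x, 2 * K ≤ N x → sInf (F x) ≠ sInf (F (-x)) := fun x hx he =>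
    hFneg x _ (hmin x hx) (he ▸ hmin (-x) (by rwa [hNneg]))
  let lab : (Fin n → ℤ) → ℤ := fun x =>
    if N x < 2 * K then
      (if altNumber (-x) < altNumber x then (altNumber x : ℤ) else -(altNumber (-x) : ℤ))
    else
      (if sInf (F x) < sInf (F (-x)) then ((2 * K + sInf (F x) : ℕ) : ℤ)
        else -((2 * K + sInf (F (-x)) : ℕ) : ℤ))
  have hzero : altNumber (0 : Fin n → ℤ) = 0 := by
    by_contra h
    obtain ⟨f, -, hf⟩ := hasAlternating_altNumber (0 : Fin n → ℤ)
    simpa using hf ⟨0, Nat.pos_of_ne_zero h⟩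
  have hlab : IsFanLabelling lab := by
    constructor
    · intro x
      simp only [lab, hNneg, neg_neg]
      split_ifs with h1 h2 h3 h3 h2 h3 h3
      · omega
      · rw [neg_neg]
      · rfl
      · by_cases hx : x = 0
        · subst hx
          simp [hzero]
        · have := altNumber_ne_neg hx
          omega
      · omega
      · rw [neg_neg]
      · rfl
      · have := hmin_ne x (by omega)
        omega
    · intro x y hx hxy he
      have hy : y ≠ 0 := by
        rintro rfl
        exact hx (funext fun c => by
          by_contra h
          exact h (hxy c h).symm)
      have hx' := altNumber_ne_neg hx
      have hy' := altNumber_ne_neg hy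
      have h1 := altNumber_mono hxy
      have h2 := altNumber_mono hxy.neg
      have hN1 : altNumber x ≤ N x := le_max_left _ _
      have hN2 : altNumber (-x) ≤ N x := le_max_right _ _
      have hN3 : altNumber y ≤ N y := le_max_left _ _
      have hN4 : altNumber (-y) ≤ N y := le_max_right _ _
      by_cases h3 : N x < 2 * K <;> by_cases h4 : N y < 2 * K
      · simp only [lab, if_pos h3, if_pos h4] at he
        split_ifs at he <;> omega
      · simp only [lab, if_pos h3, if_neg h4] at he
        split_ifs at he <;> omega
      · simp only [lab, if_neg h3, if_pos h4] at he
        split_ifs at he <;> omega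
      · simp only [lab, if_neg h3, if_neg h4] at he
        have m1 := hFmono x y hxy (hmin x (by omega))
        have m2 := hFmono (-x) (-y) hxy.neg (hmin (-x) (by rw [hNneg]; omega))
        have m3 := hmin y (by omega)
        have m4 := hmin (-y) (by rw [hNneg]; omega)
        split_ifs at he
        · omega
        · have : sInf (F x) = sInf (F (-y)) := by omega
          exact hFneg y _ m1 (this ▸ m4)
        · have : sInf (F y) = sInf (F (-x)) := by omega
          exact hFneg y _ m3 (this ▸ m2)
        · omega
  obtain ⟨x, -, hx⟩ := hlab.exists_le_abs (by omega)
  have hN1 : altNumber x ≤ N x := le_max_left _ _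
  have hN2 : altNumber (-x) ≤ N x := le_max_right _ _
  refine absurd hx (not_le.2 ?_)
  by_cases h : N x < 2 * K
  · simp only [lab, if_pos h]
    rw [abs_lt]
    split_ifs <;> omega
  · have h1 := hFlt x _ (hmin x (by omega))
    have h2 := hFlt (-x) _ (hmin (-x) (by rw [hNneg]; omega))
    have h3 := hmin_ne x (by omega)
    simp only [lab, if_neg h]
    rw [abs_lt]
    split_ifs <;> omega

end StableSets

/-! ### Wide colourings and the helical graph -/

section WideColouring

/-- The elements of `A` in the `j`-th block of `w` consecutive numbers, relative to its start. -/
def blockPart (w : ℕ) (A : Finset ℕ) (j : ℕ) : Finset ℕ :=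
  (Finset.range w).filter fun r => j * w + r ∈ A

/-- The even positions of the `j`-th block of length `2q+1` that belong to `A`. -/
def evenPart (q : ℕ) (A : Finset ℕ) (j : ℕ) : Finset ℕ :=
  (Finset.range (q + 1)).filter fun i => j * (2 * q + 1) + 2 * i ∈ A

/-- The odd positions of the `j`-th block of length `2q+1` that belong to `A`. -/
def oddPart (q : ℕ) (A : Finset ℕ) (j : ℕ) : Finset ℕ :=
  (Finset.range q).filter fun i => j * (2 * q + 1) + (2 * i + 1) ∈ A

theorem card_eq_sum_blockPart {w m : ℕ} (hw : 0 < w) {A : Finset ℕ}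
    (hA : A ⊆ Finset.range (m * w)) :
    A.card = ∑ j ∈ Finset.range m, (blockPart w A j).card := by
  rw [Finset.card_eq_sum_card_fiberwise (f := fun x => x / w) (t := Finset.range m)]
  · refine Finset.sum_congr rfl fun j _ => ?_
    refine Finset.card_nbij' (fun x => x % w) (fun r => j * w + r) ?_ ?_ ?_ ?_
    · intro x hx
      simp only [Finset.coe_filter, Set.mem_ofPred_eq] at hx
      simp only [blockPart, Finset.coe_filter, Set.mem_ofPred_eq, Finset.mem_range]
      refine ⟨Nat.mod_lt _ hw, ?_⟩
      rw [← hx.2, Nat.div_add_mod']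
      exact hx.1
    · intro r hr
      simp only [blockPart, Finset.coe_filter, Set.mem_ofPred_eq, Finset.mem_range] at hr
      simp only [Finset.coe_filter, Set.mem_ofPred_eq]
      refine ⟨hr.2, ?_⟩
      rw [Nat.mul_comm, Nat.mul_add_div hw, Nat.div_eq_of_lt hr.1, Nat.add_zero]
    · intro x hx
      simp only [Finset.coe_filter, Set.mem_ofPred_eq] at hx
      simp only
      rw [← hx.2, Nat.div_add_mod']
    · intro r hr
      simp only [blockPart, Finset.coe_filter, Set.mem_ofPred_eq, Finset.mem_range] at hr
      simp only
      rw [Nat.mul_comm, Nat.mul_add_mod, Nat.mod_eq_of_lt hr.1]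
  · intro x hx
    have := Finset.mem_range.1 (hA hx)
    exact Finset.mem_coe.2 (Finset.mem_range.2 (Nat.div_lt_of_lt_mul (by rwa [Nat.mul_comm])))

theorem card_blockPart (q : ℕ) (A : Finset ℕ) (j : ℕ) :
    (blockPart (2 * q + 1) A j).card = (evenPart q A j).card + (oddPart q A j).card := by
  have hunion : blockPart (2 * q + 1) A j =
      (evenPart q A j).image (fun i => 2 * i) ∪ (oddPart q A j).image (fun i => 2 * i + 1) := by
    ext r
    simp only [blockPart, evenPart, oddPart, Finset.mem_union, Finset.mem_image, Finset.mem_filter,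
      Finset.mem_range]
    constructor
    · rintro ⟨hr, hA⟩
      rcases Nat.even_or_odd' r with ⟨i, rfl | rfl⟩
      · exact Or.inl ⟨i, ⟨by omega, hA⟩, rfl⟩
      · exact Or.inr ⟨i, ⟨by omega, hA⟩, rfl⟩
    · rintro (⟨i, ⟨hi, hA⟩, rfl⟩ | ⟨i, ⟨hi, hA⟩, rfl⟩)
      · exact ⟨by omega, hA⟩
      · exact ⟨by omega, hA⟩
  rw [hunion, Finset.card_union_of_disjoint, Finset.card_image_of_injective,
    Finset.card_image_of_injective]
  · intro a b h
    simp only at h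
    omega
  · intro a b h
    simp only at h
    omega
  · rw [Finset.disjoint_left]
    intro r hr hr'
    obtain ⟨a, -, ha⟩ := Finset.mem_image.1 hr
    obtain ⟨b, -, hb⟩ := Finset.mem_image.1 hr'
    omega

variable {q m : ℕ} {A B : Finset ℕ}

theorem IsStable.card_blockPart_le (hA : IsStable A) (j : ℕ) :
    (blockPart (2 * q + 1) A j).card ≤ q + 1 := by
  rw [← Finset.card_range (q + 1)]
  refine Finset.card_le_card_of_injOn (fun r => r / 2) ?_ ?_
  · intro r hr
    have := (Finset.mem_filter.1 (Finset.mem_coe.1 hr)).1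
    simp only [Finset.mem_range, Finset.coe_range, Set.mem_Iio] at this ⊢
    omega
  · intro r hr r' hr' h
    have h1 := (Finset.mem_filter.1 (Finset.mem_coe.1 hr)).2
    have h2 := (Finset.mem_filter.1 (Finset.mem_coe.1 hr')).2
    have h3 := hA _ h1
    have h4 := hA _ h2
    simp only at h
    by_contra hne
    rcases lt_or_gt_of_ne hne with hlt | hlt
    · exact h3 (by rwa [show j * (2 * q + 1) + r + 1 = j * (2 * q + 1) + r' by omega])
    · exact h4 (by rwa [show j * (2 * q + 1) + r' + 1 = j * (2 * q + 1) + r by omega])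

/-- A stable set with `q + 1` elements in a block of length `2q + 1` contains all even positions. -/
theorem IsStable.mem_of_card_blockPart (hA : IsStable A) {j : ℕ}
    (h : q + 1 ≤ (blockPart (2 * q + 1) A j).card) {i : ℕ} (hi : i ≤ q) :
    j * (2 * q + 1) + 2 * i ∈ A := by
  by_contra hiA
  have hle : (blockPart (2 * q + 1) A j).card ≤ q := by
    -- Without position `2i`, the positions split into `q` pairs of neighbours.
    refine (Finset.card_le_card_of_injOn (t := Finset.range q)
      (fun r => if r < 2 * i then r / 2 else (r - 1) / 2) ?_ ?_).trans_eq (Finset.card_range q)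
    · intro r hr
      obtain ⟨h1, h2⟩ := Finset.mem_filter.1 (Finset.mem_coe.1 hr)
      have hne : r ≠ 2 * i := by
        rintro rfl
        exact hiA h2
      simp only [Finset.mem_range, Finset.coe_range, Set.mem_Iio] at h1 ⊢
      split_ifs <;> omega
    · intro r hr r' hr' h
      have h1 := (Finset.mem_filter.1 (Finset.mem_coe.1 hr)).2
      have h2 := (Finset.mem_filter.1 (Finset.mem_coe.1 hr')).2
      have hne : r ≠ 2 * i := by
        rintro rfl
        exact hiA h1
      have hne' : r' ≠ 2 * i := by
        rintro rfl
        exact hiA h2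
      have h3 := hA _ h1
      have h4 := hA _ h2
      simp only at h
      by_contra hrr
      rcases lt_or_gt_of_ne hrr with hlt | hlt
      · refine h3 ?_
        rwa [show j * (2 * q + 1) + r + 1 = j * (2 * q + 1) + r' by split_ifs at h <;> omega]
      · refine h4 ?_
        rwa [show j * (2 * q + 1) + r' + 1 = j * (2 * q + 1) + r by split_ifs at h <;> omega]
  omega

theorem card_evenPart_add_le (h : Disjoint A B) (j : ℕ) :
    (evenPart q A j).card + (evenPart q B j).card ≤ q + 1 := by
  rw [← Finset.card_union_of_disjoint]
  · exact (Finset.card_le_card (Finset.union_subset (Finset.filter_subset _ _)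
      (Finset.filter_subset _ _))).trans_eq (Finset.card_range (q + 1))
  · exact Finset.disjoint_filter.2 fun i _ hi => Finset.disjoint_left.1 h hi

theorem card_oddPart_add_le (h : Disjoint A B) (j : ℕ) :
    (oddPart q A j).card + (oddPart q B j).card ≤ q := by
  rw [← Finset.card_union_of_disjoint]
  · exact (Finset.card_le_card (Finset.union_subset (Finset.filter_subset _ _)
      (Finset.filter_subset _ _))).trans_eq (Finset.card_range q)
  · exact Finset.disjoint_filter.2 fun i _ hi => Finset.disjoint_left.1 h hi

theorem IsStable.le_card_blockPart (hA : IsStable A) (hsub : A ⊆ Finset.range (m * (2 * q + 1)))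
    (hcard : m * q + 1 ≤ A.card) {j : ℕ} (hj : j < m) :
    q + 2 ≤ (blockPart (2 * q + 1) A j).card + m := by
  rw [card_eq_sum_blockPart (by omega) hsub,
    ← Finset.add_sum_erase _ _ (Finset.mem_range.2 hj)] at hcard
  have h1 := Finset.sum_le_card_nsmul ((Finset.range m).erase j)
    (fun j => (blockPart (2 * q + 1) A j).card) (q + 1) fun i _ => hA.card_blockPart_le i
  rw [Finset.card_erase_of_mem (Finset.mem_range.2 hj), Finset.card_range, smul_eq_mul] at h1
  obtain ⟨m', rfl⟩ := Nat.exists_eq_add_of_lt (Nat.zero_lt_of_lt hj)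
  rw [Nat.zero_add, Nat.add_sub_cancel] at h1
  rw [Nat.zero_add] at hcard
  have h2 : m' * (q + 1) = m' * q + m' := by ring
  have h3 : (m' + 1) * q = m' * q + q := by ring
  omega

theorem IsStable.exists_full_block (hA : IsStable A)
    (hsub : A ⊆ Finset.range (m * (2 * q + 1))) (hcard : m * q + 1 ≤ A.card) :
    ∃ j < m, ∀ i ≤ q, j * (2 * q + 1) + 2 * i ∈ A := by
  rw [card_eq_sum_blockPart (by omega) hsub] at hcard
  obtain ⟨j, hj, h⟩ : ∃ j ∈ Finset.range m, q < (blockPart (2 * q + 1) A j).card := by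
    by_contra! h
    have := Finset.sum_le_card_nsmul _ _ _ h
    rw [Finset.card_range, smul_eq_mul] at this
    omega
  exact ⟨j, Finset.mem_range.1 hj, fun i hi => hA.mem_of_card_blockPart h hi⟩

/-- Schrijver graphs with long blocks have wide colourings (Simonyi–Tardos): colour a stable set by
a block whose even positions it contains. Along a walk, the sets stay close to the even and to the
odd positions of this block alternately; the deviation grows by at most `m` in each step. -/
theorem stableKneser_power_colorable {t : ℕ} (ht : Odd t) (hq : t * m ≤ q) :
    ((stableKneser (m * (2 * q + 1)) (m * q + 1)).power t).Colorable m := by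
  choose c hcm hc using fun A : {A : Finset ℕ // A ⊆ Finset.range (m * (2 * q + 1)) ∧
    IsStable A ∧ m * q + 1 ≤ A.card} => A.2.2.1.exists_full_block A.2.1 A.2.2.2
  refine ⟨fun A => ⟨c A, hcm A⟩, fun A B hAB he => ?_⟩
  have hcAB : c A = c B := congrArg Fin.val he
  obtain ⟨p, h0, h1, hp⟩ := LoopGraph.HasWalk.exists_seq hAB
  have key : ∀ r ≤ t, (Even r → (oddPart q (p r).1 (c A)).card ≤ r * m) ∧
      (Odd r → (evenPart q (p r).1 (c A)).card ≤ r * m) := by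
    intro r
    induction r with
    | zero =>
      refine fun _ => ⟨fun _ => ?_, fun h => absurd h (by decide)⟩
      rw [h0, Nat.zero_mul, Nat.le_zero, Finset.card_eq_zero, oddPart, Finset.filter_eq_empty_iff]
      intro i hi
      exact A.2.2.1 _ (hc A i (Finset.mem_range.1 hi).le)
    | succ r ih =>
      intro hr
      have hlow := (p r).2.2.1.le_card_blockPart (p r).2.1 (p r).2.2.2 (hcm A)
      rw [card_blockPart] at hlow
      have hE := card_evenPart_add_le (q := q) (hp r (by omega)) (c A)
      have hO := card_oddPart_add_le (q := q) (hp r (by omega)) (c A)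
      have hmul : (r + 1) * m = r * m + m := by ring
      refine ⟨fun h => ?_, fun h => ?_⟩
      · have := (ih (by omega)).2 (by
          rw [Nat.even_add_one] at h
          exact Nat.not_even_iff_odd.1 h)
        omega
      · have := (ih (by omega)).1 (by
          rw [Nat.odd_add_one] at h
          exact Nat.not_odd_iff_even.1 h)
        omega
  have hfull : (evenPart q (p t).1 (c A)).card = q + 1 := by
    rw [h1, hcAB, evenPart, Finset.filter_true_of_mem, Finset.card_range]
    exact fun i hi => hc B i (by rw [Finset.mem_range] at hi; omega)
  have := (key t le_rfl).2 ht
  omega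

end WideColouring

section Helical

variable {V : Type*} {k m : ℕ}

open LoopGraph

theorem nonempty_helicalVertex (hm : 2 ≤ m) : Nonempty (HelicalVertex m 1 k) := by
  refine ⟨⟨fun i => {⟨(i : ℕ) % 2, by omega⟩}, ?_, ?_, ?_, ?_⟩⟩
  · simp
  · simp
  · intro s s' h
    simp only [Finset.disjoint_singleton, ne_eq, Fin.mk.injEq]
    omega
  · intro t t' h
    simp only [Finset.singleton_subset_singleton, Fin.mk.injEq]
    omega

open Classical in
/-- The colours of the vertices at walk distance `r` from `u`. -/
noncomputable def colourBall (G : LoopGraph V) (c : V → Fin m) (u : V) (r : ℕ) : Finset (Fin m) :=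
  Finset.univ.filter fun a => ∃ v, G.HasWalk r u v ∧ c v = a

theorem mem_colourBall {G : LoopGraph V} {c : V → Fin m} {u : V} {r : ℕ} {a : Fin m} :
    a ∈ colourBall G c u r ↔ ∃ v, G.HasWalk r u v ∧ c v = a := by
  simp [colourBall]

/-- The universal property of the helical graph: a graph whose `(2k-1)`-st power has a proper
colouring with `m` colours maps to `H(m,1,k)`. The image of a vertex lists the sets of colours at
walk distance `0, 1, …, k-1`. -/
theorem exists_isHom_helical {G : LoopGraph V} (hm : 2 ≤ m)
    (h : (G.power (2 * k + 1)).Colorable m) : ∃ f, G.IsHom (helical m 1 (k + 1)) f := by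
  classical
  obtain ⟨c, hc⟩ := h
  have hne : ∀ {r u v}, r ≤ k → G.HasWalk (2 * r + 1) u v → c u ≠ c v := fun hr hw =>
    hc _ _ (hw.of_odd_le ⟨_, rfl⟩ ⟨_, rfl⟩ (by omega))
  have hlong : ∀ {u w}, G.Adj u w → ∀ r, ∃ v, G.HasWalk r u v := by
    intro u w huw r
    induction r using Nat.twoStepInduction with
    | zero => exact ⟨u, rfl⟩
    | one => exact ⟨w, hasWalk_one.2 huw⟩
    | more r ih _ =>
      obtain ⟨v, hv⟩ := ih
      exact ⟨v, w, huw, u, G.symm _ _ huw, hv⟩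
  -- The conditions below fail for isolated vertices, whose image is irrelevant.
  have hvert : ∀ u w, G.Adj u w → ∃ A : HelicalVertex m 1 (k + 1),
      ∀ r, A.1 r = colourBall G c u r := by
    intro u w huw
    refine ⟨⟨fun r => colourBall G c u r, ?_, ?_, ?_, ?_⟩, fun r => rfl⟩
    · intro r hr
      simp only [hr, Finset.card_eq_one]
      refine ⟨c u, Finset.eq_singleton_iff_unique_mem.2 ⟨mem_colourBall.2 ⟨u, rfl, rfl⟩, ?_⟩⟩
      intro a ha
      obtain ⟨v, hv, rfl⟩ := mem_colourBall.1 ha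
      exact congrArg c (Eq.symm hv)
    · intro r
      obtain ⟨v, hv⟩ := hlong huw r
      exact Finset.card_pos.2 ⟨c v, mem_colourBall.2 ⟨v, hv, rfl⟩⟩
    · intro s s' hs
      simp only [hs, Finset.disjoint_left]
      intro a ha ha'
      obtain ⟨v, hv, rfl⟩ := mem_colourBall.1 ha
      obtain ⟨v', hv', he⟩ := mem_colourBall.1 ha'
      refine hne (r := s) (by omega) (?_ : G.HasWalk (2 * s + 1) v v') he.symm
      have := hv.reverse.append hv'
      rwa [show (s : ℕ) + (s + 1) = 2 * s + 1 by omega] at this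
    · intro s s' hs a ha
      simp only [hs]
      obtain ⟨v, hv, rfl⟩ := mem_colourBall.1 ha
      exact mem_colourBall.2 ⟨v, ⟨w, huw, u, G.symm _ _ huw, hv⟩, rfl⟩
  obtain ⟨A0⟩ := nonempty_helicalVertex (k := k + 1) hm
  have hf : ∀ u, ∃ A : HelicalVertex m 1 (k + 1),
      (∃ w, G.Adj u w) → ∀ r, A.1 r = colourBall G c u r := by
    intro u
    by_cases hu : ∃ w, G.Adj u w
    · obtain ⟨w, hw⟩ := hu
      obtain ⟨A, hA⟩ := hvert u w hw
      exact ⟨A, fun _ => hA⟩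
    · exact ⟨A0, fun h => absurd h hu⟩
  choose f hf using hf
  have hstep : ∀ u w, G.Adj u w → ∀ r, colourBall G c u r ⊆ colourBall G c w (r + 1) := by
    intro u w huw r a ha
    obtain ⟨v, hv, rfl⟩ := mem_colourBall.1 ha
    exact mem_colourBall.2 ⟨v, ⟨u, G.symm _ _ huw, hv⟩, rfl⟩
  refine ⟨f, fun u w huw => ⟨fun i => ?_, fun j j' hj => ?_⟩⟩
  · rw [hf u ⟨w, huw⟩, hf w ⟨u, G.symm _ _ huw⟩, Finset.disjoint_left]
    intro a ha ha'
    obtain ⟨v, hv, rfl⟩ := mem_colourBall.1 ha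
    obtain ⟨v', hv', he⟩ := mem_colourBall.1 ha'
    refine hne (r := i) (by omega) (?_ : G.HasWalk (2 * i + 1) v v') he.symm
    have := (hv.reverse.concat huw).append hv'
    rwa [show (i : ℕ) + 1 + i = 2 * i + 1 by omega] at this
  · rw [hf u ⟨w, huw⟩, hf w ⟨u, G.symm _ _ huw⟩, hf u ⟨w, huw⟩, hf w ⟨u, G.symm _ _ huw⟩, hj]
    exact ⟨hstep u w huw j, hstep w u (G.symm _ _ huw) j⟩

theorem helical_power_colorable (m k : ℕ) :
    ((helical m 1 (k + 1)).power (2 * k + 1)).Colorable m := by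
  have hne : ∀ A : HelicalVertex m 1 (k + 1), (A.1 0).Nonempty := fun A =>
    Finset.card_pos.1 (A.2.2.1 0)
  choose c hc using hne
  -- Proper colourings are homomorphisms to the complete graph.
  let X : LoopGraph (Fin m) := ⟨fun a b => a ≠ b, fun _ _ h => h.symm⟩
  have h := isHom_power_of_balls (G := helical m 1 (k + 1)) (X := X) (f := c) (s := k)
    (fun r A => {a | ∃ h : r < k + 1, a ∈ A.1 ⟨r, h⟩}) (fun A => ⟨Nat.succ_pos k, hc A⟩)
    (fun r hr A B hAB a ⟨h, ha⟩ => ⟨by omega, (hAB.2 ⟨r, h⟩ ⟨r + 1, by omega⟩ rfl).1 ha⟩)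
    (fun A B hAB a ⟨h, ha⟩ b ⟨_, hb⟩ => Finset.disjoint_iff_ne.1 (hAB.1 ⟨k, h⟩) a ha b hb)
  exact ⟨c, h⟩

/-- The chromatic number of the helical graph `H(m,1,k)` is at least `m`. -/
theorem le_of_helical_colorable {C : ℕ} (hm : 2 ≤ m)
    (h : (helical m 1 (k + 1)).Colorable C) : m ≤ C := by
  obtain ⟨f, hf⟩ := exists_isHom_helical hm
    (stableKneser_power_colorable (m := m) (t := 2 * k + 1) ⟨k, rfl⟩ le_rfl)
  have h1 : m * (2 * ((2 * k + 1) * m) + 1) = 2 * (m * ((2 * k + 1) * m)) + m := by ring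
  have := lt_of_stableKneser_colorable (Nat.succ_pos _) (by omega) (hf.colorable h)
  omega

end Helical

/-! ### Cores and power thickness -/

namespace LoopGraph

section Cores

variable {V : Type*}

/-- The subgraph of `G` induced on `T`. -/
def induce (G : LoopGraph V) (T : Set V) : LoopGraph T where
  Adj u v := G.Adj u v
  symm u v h := G.symm u v h

/-- Every endomorphism is injective. A finite graph with this property is a core in the usual sense:
it has no homomorphism to a proper subgraph. -/
def IsCore (C : LoopGraph V) : Prop :=
  ∀ f, C.IsHom C f → Function.Injective f

/-- Every finite graph maps to an induced subgraph that is a core. -/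
theorem exists_isCore_induce [Finite V] (G : LoopGraph V) :
    ∃ T : Set V, (G.induce T).IsCore ∧ ∃ f, G.IsHom (G.induce T) f := by
  obtain ⟨T, ⟨f, hf⟩, hT⟩ := (Set.toFinite {T : Set V | ∃ f, G.IsHom (G.induce T) f}).exists_minimal
    ⟨Set.univ, fun v => ⟨v, trivial⟩, fun _ _ h => h⟩
  refine ⟨T, fun h hh => Finite.injective_iff_surjective.2 fun t => ?_, f, hf⟩
  have hmem : (Subtype.val '' Set.range h) ∈ {T : Set V | ∃ f, G.IsHom (G.induce T) f} :=
    ⟨fun v => ⟨h (f v), h (f v), ⟨f v, rfl⟩, rfl⟩, fun _ _ huv => hh _ _ (hf _ _ huv)⟩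
  have hsub : (Subtype.val '' Set.range h) ≤ T := by
    rintro _ ⟨x, -, rfl⟩
    exact x.2
  obtain ⟨x, hx, hxt⟩ := hT hmem hsub t.2
  rwa [Subtype.val_injective hxt] at hx

/-- A core cannot be folded. -/
theorem IsCore.eq_of_forall_adj {C : LoopGraph V} (hC : C.IsCore) {u v : V}
    (h : ∀ w, C.Adj u w → C.Adj v w) : u = v := by
  classical
  by_contra hne
  have hf : C.IsHom C (Function.update id u v) := by
    intro x y hxy
    by_cases hx : x = u <;> by_cases hy : y = u
    · subst hx hy
      simp only [Function.update_self]
      exact h _ (C.symm _ _ (h _ hxy))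
    · subst hx
      simpa [Function.update_of_ne hy] using h _ hxy
    · subst hy
      simpa [Function.update_of_ne hx] using C.symm _ _ (h _ (C.symm _ _ hxy))
    · simpa [Function.update_of_ne hx, Function.update_of_ne hy] using hxy
  have := hC _ hf (a₁ := u) (a₂ := v) (by simp [Function.update_of_ne (Ne.symm hne)])
  exact hne this

theorem IsHom.iterate {C : LoopGraph V} {f : V → V} (hf : C.IsHom C f) (n : ℕ) :
    C.IsHom C f^[n] := by
  induction n with
  | zero => exact fun _ _ h => h
  | succ n ih => exact ih.comp hf

theorem exists_iterate_leftInverse [Finite V] {f : V → V} (hf : Function.Injective f) :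
    ∃ n, ∀ v, f^[n] (f v) = v := by
  let e : Equiv.Perm V := Equiv.ofBijective f (Finite.injective_iff_bijective.1 hf)
  obtain ⟨n, hn, he⟩ := (isOfFinOrder_of_finite e).exists_pow_eq_one
  refine ⟨n - 1, fun v => ?_⟩
  rw [← Function.iterate_succ_apply, Nat.succ_eq_add_one, Nat.sub_add_cancel hn]
  have h : (e ^ n) v = v := by rw [he]; rfl
  rwa [← Equiv.Perm.iterate_eq_pow] at h

/-- If every vertex has at most one neighbour, the graph is a matching, hence bipartite. -/
theorem colorable_two_of_adj_unique {C : LoopGraph V} (hloop : ∀ v, ¬ C.Adj v v)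
    (h : ∀ x u v, C.Adj x u → C.Adj x v → u = v) : C.Colorable 2 := by
  classical
  let _ : LinearOrder V := linearOrderOfSTO WellOrderingRel
  have key : ∀ u v, C.Adj u v → u < v →
      (∃ y, C.Adj u y ∧ u < y) ∧ ¬ ∃ y, C.Adj v y ∧ v < y := by
    refine fun u v huv hlt => ⟨⟨v, huv, hlt⟩, ?_⟩
    rintro ⟨y, hy, hvy⟩
    rw [h v y u hy (C.symm _ _ huv)] at hvy
    exact lt_asymm hlt hvy
  refine ⟨fun x => if ∃ y, C.Adj x y ∧ x < y then 0 else 1, fun u v huv => ?_⟩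
  have hne : u ≠ v := by
    rintro rfl
    exact hloop u huv
  rcases lt_or_gt_of_ne hne with hlt | hlt
  · obtain ⟨h1, h2⟩ := key u v huv hlt
    simp only [if_pos h1, if_neg h2]
    decide
  · obtain ⟨h1, h2⟩ := key v u (C.symm _ _ huv) hlt
    simp only [if_pos h1, if_neg h2]
    decide

/-- A finite core `C` is bipartite if some power of its `(2s+1)`-subdivision of exponent greater than
`2s+1` maps to `C`: the points `(uv)_i` are sent to `u`, up to an automorphism, and then walks
between the points `(uv)_s` show that ends of `3`-walks are adjacent. -/
theorem IsCore.colorable_two [Finite V] {C : LoopGraph V} (hC : C.IsCore)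
    (hloop : ∀ v, ¬ C.Adj v v) {s e : ℕ} (he : Odd e) (hse : 2 * s + 1 < e)
    {f : C.SubdivVertex s → V} (hf : ((C.oddSubdivision s).power e).IsHom C f) :
    C.Colorable 2 := by
  have hσ : C.IsHom C (f ∘ Sum.inl) := fun u v huv =>
    hf _ _ ((isHom_inl_power_oddSubdivision C s u v huv).of_odd_le ⟨s, rfl⟩ he hse.le)
  obtain ⟨n, hn⟩ := exists_iterate_leftInverse (hC _ hσ)
  obtain ⟨g, hg, hgbase⟩ : ∃ g : C.SubdivVertex s → V,
      (∀ x y, (C.oddSubdivision s).HasWalk (2 * s + 3) x y → C.Adj (g x) (g y)) ∧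
      ∀ v, g (Sum.inl v) = v := by
    refine ⟨(f ∘ Sum.inl)^[n] ∘ f, fun x y hxy => ?_, hn⟩
    refine hσ.iterate n _ _ (hf _ _ (hxy.of_odd_le ⟨s + 1, by ring⟩ he ?_))
    obtain ⟨j, rfl⟩ := he
    omega
  have hpoint : ∀ (i : ℕ) (hi : i < s + 1) (d : C.Dart), g (C.subdivPoint s d ⟨i, hi⟩) = d.1.1 := by
    intro i
    induction i with
    | zero => exact fun _ d => hgbase d.1.1
    | succ i ih =>
      intro hi d
      refine (hC.eq_of_forall_adj fun w hw => ?_).symm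
      let d' : C.Dart := ⟨(w, d.1.1), C.symm _ _ hw⟩
      have hw1 := (hasWalk_inl_subdivPoint d (i + 1) hi).reverse.append
        (hasWalk_subdivPoint_inl d' i (Nat.lt_of_succ_lt hi)).reverse
      rw [show 2 * (i + 1) + (2 * (s - i) + 1) = 2 * s + 3 by omega] at hw1
      have h := hg _ _ hw1
      rwa [ih _ d'] at h
  have h3 : ∀ u v v' u', C.Adj u v → C.Adj v v' → C.Adj v' u' → C.Adj u u' := by
    intro u v v' u' h1 h2 h3
    let d : C.Dart := ⟨(u, v), h1⟩
    let d' : C.Dart := ⟨(u', v'), C.symm _ _ h3⟩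
    have hw := ((hasWalk_subdivPoint_inl d s (Nat.lt_succ_self s)).append
      (isHom_inl_power_oddSubdivision C s v v' h2)).append
      (hasWalk_subdivPoint_inl d' s (Nat.lt_succ_self s)).reverse
    rw [show 2 * (s - s) + 1 + (2 * s + 1) + (2 * (s - s) + 1) = 2 * s + 3 by omega] at hw
    have h := hg _ _ hw
    rwa [hpoint _ _ d, hpoint _ _ d'] at h
  exact colorable_two_of_adj_unique hloop fun x u v hu hv =>
    hC.eq_of_forall_adj fun y hy => h3 v x u y (C.symm _ _ hv) hu hy

theorem HasOddCycle.exists_hasWalk {G : LoopGraph V} {n : ℕ} (h : G.HasOddCycle n) :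
    ∃ v, G.HasWalk n v v := by
  obtain ⟨-, c, -, hc⟩ := h
  have := hasWalk_of_seq (G := G) (n := n) (fun i => c (i : ZMod n)) fun i _ => by
    simpa using hc i
  exact ⟨c 0, by simpa using this⟩

end Cores

end LoopGraph

section Thickness

open LoopGraph

variable {m k l : ℕ}

theorem helical_odd_power_colorable (hlk : l ≤ k) :
    ((helical m 1 (k + 1)).power (2 * l + 1)).Colorable m := by
  have h : ((helical m 1 (k + 1)).power (2 * l + 1)).IsHom
      ((helical m 1 (k + 1)).power (2 * k + 1)) id := fun u v huv =>
    HasWalk.of_odd_le huv ⟨l, rfl⟩ ⟨k, rfl⟩ (by omega)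
  exact h.colorable (helical_power_colorable m k)

theorem le_of_helical_odd_power_colorable {C : ℕ} (hm : 2 ≤ m)
    (h : ((helical m 1 (k + 1)).power (2 * l + 1)).Colorable C) : m ≤ C :=
  le_of_helical_colorable hm ((isHom_power_of_odd _ ⟨l, rfl⟩).colorable h)

theorem helical_odd_power_chromaticNumber (hm : 2 ≤ m) (hlk : l ≤ k) :
    ((helical m 1 (k + 1)).power (2 * l + 1)).chromaticNumber = m :=
  le_antisymm (chromaticNumber_le_iff.2 (helical_odd_power_colorable hlk))
    (le_iInf₂ fun _ hC => Nat.cast_le.2 (le_of_helical_odd_power_colorable hm hC))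

theorem fracPower_helical_colorable (hlk : l ≤ k) :
    (((helical m 1 (k + 1)).power (2 * l + 1)).fracPower k l).Colorable m := by
  obtain ⟨g, -, hg⟩ := exists_isHom_oddSubdivision (f := id) (X := helical m 1 (k + 1)) (s := l)
    (helical_odd_power_colorable (m := m) hlk).not_adj_self fun _ _ h => h
  exact (hg.power (2 * k + 1)).colorable (helical_power_colorable m k)

theorem lt_mul_of_hasOddCycle {n : ℕ}
    (h : ((helical m 1 (k + 1)).power (2 * l + 1)).HasOddCycle n) :
    2 * k + 1 < (2 * l + 1) * n := by
  obtain ⟨v, hv⟩ := h.exists_hasWalk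
  by_contra hle
  exact (helical_power_colorable m k).not_adj_self v ((hasWalk_power.1 hv).of_odd_le
    (Odd.mul ⟨l, rfl⟩ h.1) ⟨k, rfl⟩ (not_lt.1 hle))

theorem lt_oddGirth_helical_odd_power :
    ENNReal.ofReal ((2 * (k : ℝ) + 1) / (2 * (l : ℝ) + 1)) <
      (((helical m 1 (k + 1)).power (2 * l + 1)).oddGirth : ENNReal) := by
  have hle : (((2 * k + 1) / (2 * l + 1) + 1 : ℕ) : ℕ∞) ≤
      ((helical m 1 (k + 1)).power (2 * l + 1)).oddGirth := by
    refine le_iInf₂ fun n hn => Nat.cast_le.2 ?_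
    exact Nat.div_lt_of_lt_mul (lt_mul_of_hasOddCycle hn)
  have hlt : (2 * (k : ℝ) + 1) / (2 * (l : ℝ) + 1) <
      (((2 * k + 1) / (2 * l + 1) + 1 : ℕ) : ℝ) := by
    rw [div_lt_iff₀ (by positivity)]
    have := Nat.lt_mul_div_succ (2 * k + 1) (Nat.succ_pos (2 * l))
    rw [Nat.succ_eq_add_one, Nat.mul_comm (2 * l + 1)] at this
    exact_mod_cast this
  calc ENNReal.ofReal ((2 * (k : ℝ) + 1) / (2 * (l : ℝ) + 1))
      < ENNReal.ofReal (((2 * k + 1) / (2 * l + 1) + 1 : ℕ) : ℝ) :=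
        (ENNReal.ofReal_lt_ofReal_iff (by positivity)).2 hlt
    _ = (((2 * k + 1) / (2 * l + 1) + 1 : ℕ) : ENNReal) := ENNReal.ofReal_natCast _
    _ ≤ _ := by exact_mod_cast ENat.toENNReal_le.2 hle

/-- Let `C` be the core of `G = H(m,1,k+1)^a`, where `a = 2l+1`, `b = 2k+1`, `c = 2r+1` and
`d = 2s+1`. An `m`-colouring of the `c`-th power of the `d`-subdivision of `C` gives an `m`-colouring
of the `b`-th power of the `a`-subdivision of `Y`, where `Y` is the `ca`-th power of the
`db`-subdivision of `C`. By the universal property of the helical graph, `Y` maps to `G`, hence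
to `C`, which is impossible for a core when `db < ca`. -/
theorem mul_le_mul_of_fracPower_colorable {r s : ℕ} (hm : 3 ≤ m) (hlk : l ≤ k)
    (h : (((helical m 1 (k + 1)).power (2 * l + 1)).fracPower r s).Colorable m) :
    (2 * r + 1) * (2 * l + 1) ≤ (2 * s + 1) * (2 * k + 1) := by
  have : Finite (HelicalVertex m 1 (k + 1)) := Subtype.finite
  by_contra! hlt
  set G := (helical m 1 (k + 1)).power (2 * l + 1)
  obtain ⟨T, hcore, ρ, hρ⟩ := exists_isCore_induce G
  set C := G.induce T
  have hCG : C.IsHom G Subtype.val := fun _ _ h => h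
  have hC : ∀ v, ¬ C.Adj v v := fun v =>
    (helical_odd_power_colorable (m := m) hlk).not_adj_self (v : HelicalVertex m 1 (k + 1))
  -- `Z` is the `abd`-subdivision of `C`, and its `abc`-th power is `m`-colourable.
  let S := C.oddSubdivision s
  let S' := S.oddSubdivision k
  let Z := S'.oddSubdivision l
  have hS : (S.power (2 * r + 1)).Colorable m := by
    obtain ⟨g, -, hg⟩ := exists_isHom_oddSubdivision_map s hC hCG
    exact (hg.power _).colorable h
  have hZ : (Z.power ((2 * l + 1) * ((2 * k + 1) * (2 * r + 1)))).Colorable m := by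
    have hhom : (Z.power ((2 * l + 1) * ((2 * k + 1) * (2 * r + 1)))).IsHom (S.power (2 * r + 1))
        (S.subdivBase k ∘ S'.subdivBase l) := fun x y hxy =>
      (isHom_subdivBase S k).hasWalk (hasWalk_power.2
        ((isHom_subdivBase S' l).hasWalk (hasWalk_power.2 hxy)))
    exact hhom.colorable hS
  obtain ⟨t, ht⟩ : Odd ((2 * s + 1) * (2 * k + 1)) := Odd.mul ⟨s, rfl⟩ ⟨k, rfl⟩
  have hCZ : C.IsHom ((Z.power (2 * l + 1)).power (2 * t + 1))
      (Sum.inl ∘ Sum.inl ∘ Sum.inl) := by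
    intro u v huv
    have h1 := isHom_inl_power_oddSubdivision C s u v huv
    have h2 := hasWalk_power.1 ((isHom_inl_power_oddSubdivision S k).hasWalk h1)
    rw [Nat.mul_comm, ht] at h2
    exact (isHom_inl_power_oddSubdivision S' l).hasWalk h2
  obtain ⟨g, -, hg⟩ := exists_isHom_oddSubdivision hC hCZ
  let Y := (C.oddSubdivision t).power ((2 * r + 1) * (2 * l + 1))
  -- A loop of `Y` is a closed walk of length `ca ≤ cb`, which would make a closed walk of length
  -- `abc` in `Z`.
  have hY : ∀ x, ¬ Y.Adj x x := by
    intro x hx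
    have h1 : (C.oddSubdivision t).HasWalk ((2 * k + 1) * (2 * r + 1)) x x :=
      HasWalk.of_odd_le hx (Odd.mul ⟨r, rfl⟩ ⟨l, rfl⟩) (Odd.mul ⟨k, rfl⟩ ⟨r, rfl⟩) (by
        rw [Nat.mul_comm (2 * k + 1)]
        exact Nat.mul_le_mul_left _ (by omega))
    exact hZ.not_adj_self _ (hasWalk_power.1 (hg.hasWalk h1))
  have hYZ : Y.IsHom ((Z.power ((2 * r + 1) * (2 * l + 1))).power (2 * l + 1)) g := by
    intro x y hxy
    refine hasWalk_power.2 ?_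
    rw [Nat.mul_comm]
    exact hasWalk_power.1 (hg.hasWalk hxy)
  obtain ⟨g', -, hg'⟩ := exists_isHom_oddSubdivision hY hYZ
  have hcol : ((Y.oddSubdivision l).power (2 * k + 1)).Colorable m := by
    have hhom : ((Y.oddSubdivision l).power (2 * k + 1)).IsHom
        (Z.power ((2 * l + 1) * ((2 * k + 1) * (2 * r + 1)))) g' := by
      intro x y hxy
      have := hasWalk_power.1 (hg'.hasWalk hxy)
      rwa [show (2 * r + 1) * (2 * l + 1) * (2 * k + 1) =
        (2 * l + 1) * ((2 * k + 1) * (2 * r + 1)) by ring] at this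
    exact hhom.colorable hZ
  obtain ⟨φ, hφ⟩ := exists_isHom_helical (by omega) hcol
  have hψ : Y.IsHom C (ρ ∘ φ ∘ Sum.inl) :=
    hρ.comp ((hφ.power (2 * l + 1)).comp (isHom_inl_power_oddSubdivision Y l))
  have h2 := hcore.colorable_two hC (Odd.mul ⟨r, rfl⟩ ⟨l, rfl⟩) (ht ▸ hlt) hψ
  have := le_of_helical_odd_power_colorable (by omega) (hρ.colorable h2)
  omega

end Thickness

/-- For positive integers `k`, `l`, `m` with `m ≥ 3` and `(2l-1)/(2k-1) ≤ 1`, the graph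
`H(m,1,k)^(2l-1)` is loopless and non-bipartite (so that its power thickness is defined), and its
power thickness is `(2k-1)/(2l-1)`. -/
theorem theorem3 (k l m : ℕ) (hk : 0 < k) (hl : 0 < l) (hm : 3 ≤ m)
    (hlk : (2 * (l : ℝ) - 1) / (2 * (k : ℝ) - 1) ≤ 1) :
    (∀ v, ¬ ((helical m 1 k).power (2 * l - 1)).Adj v v) ∧
    ¬ ((helical m 1 k).power (2 * l - 1)).Colorable 2 ∧
    ((helical m 1 k).power (2 * l - 1)).powerThickness =
      (2 * (k : ℝ) - 1) / (2 * (l : ℝ) - 1) := by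
  obtain ⟨k, rfl⟩ := Nat.exists_eq_add_of_le' hk
  obtain ⟨l, rfl⟩ := Nat.exists_eq_add_of_le' hl
  have hcast : ∀ n : ℕ, 2 * ((n + 1 : ℕ) : ℝ) - 1 = 2 * (n : ℝ) + 1 := fun n => by push_cast; ring
  rw [hcast, hcast, div_le_one (by positivity)] at hlk
  rw [hcast, hcast, show 2 * (l + 1) - 1 = 2 * l + 1 by omega]
  replace hlk : l ≤ k := by
    have : (l : ℝ) ≤ k := by linarith
    exact_mod_cast this
  have hχ := helical_odd_power_chromaticNumber (m := m) (by omega) hlk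
  refine ⟨(helical_odd_power_colorable hlk).not_adj_self, fun h => ?_, IsGreatest.csSup_eq ⟨?_, ?_⟩⟩
  · have := le_of_helical_odd_power_colorable (by omega) h
    omega
  · refine ⟨k, l, rfl, ?_, lt_oddGirth_helical_odd_power⟩
    rw [hχ]
    exact LoopGraph.chromaticNumber_le_iff.2 (fracPower_helical_colorable hlk)
  · rintro x ⟨r, s, rfl, hrs, -⟩
    rw [hχ] at hrs
    have := mul_le_mul_of_fracPower_colorable hm hlk (LoopGraph.chromaticNumber_le_iff.1 hrs)
    rw [div_le_div_iff₀ (by positivity) (by positivity), mul_comm (2 * (k : ℝ) + 1)]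
    exact_mod_cast this
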